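/- **Theorem.** Let $M$ be a smooth connected paracompact Hausdorff manifold of dimension $n\ge 1$, let $F\colon TM\to[0,\infty)$ be a Finsler metric on $M$ (continuous, smooth and positive off the zero section, fiberwise positively homogeneous of degree $1$, with positive definite vertical Hessian $\frac12\frac{\partial^2F^2}{\partial v^i\partial v^j}$ off the zero section; not necessarily reversible), and let $\Lambda\colon M\to(0,\infty)$ be smooth. Consider the standard static Finsler spacetime $\tilde M=\mathbb R\times M$ with Finsler function $L(\tau,v)=-\Lambda\tau^2+F(v)^2$, and let $\tilde g_w=\frac12\,\partial_v^2L(w)$ be its vertical Hessian at the tangent vectors $w$ not in the line bundle $\mathcal T$ spanned by $\partial_t$. A vector $w$ is *causal* if either $w\in\mathcal T\setminus 0$ or $w\notin\mathcal T$ and $\tilde g_w(w,w)\le 0$; a causal $w$ is *future-pointing* if it is a positive multiple of $\partial_t$ or $w\notin\mathcal T$ and $\tilde g_w(w,\partial_t)<0$. A *future-pointing causal curve* is a continuous piecewise smooth curve on an interval $[a,b]$, $a<b$, all of whose one-sided derivatives are future-pointing causal. Write $p\le q$ if $p=q$ or there is a future-pointing causal curve from $p$ to $q$, and put $J^+(p)=\{q: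 p\le q\}$, $J^-(p)=\{q: q\le p\}$. The spacetime $(\tilde M,L)$ is *causally simple* if $J^+(p)$ and $J^-(p)$ are closed for every $p\in\tilde M$ and there is no closed future-pointing causal curve. Let $\tilde F=F/\sqrt\Lambda$. The $\tilde F$-length of a continuous piecewise smooth curve $\sigma\colon[a,b]\to M$ is $\int_a^b\tilde F(\dot\sigma)\,ds$, and $\tilde d(x,y)$ is the infimum of the $\tilde F$-lengths of such curves from $x$ to $y$. A *geodesic* of $\tilde F$ is a continuous piecewise smooth curve $\sigma\colon[a,b]\to M$, $a<b$, possibly constant, that is a critical point of the energy $\frac12\int_a^b\tilde F(\dot\sigma)^2\,ds$ with respect to all variations of $\sigma$ with fixed endpoints (continuous on $(-\varepsilon,\varepsilon)\times[a,b]$ and smooth on each strip $(-\varepsilon,\varepsilon)\times[s_{j-1},s_j]$ of some subdivision of $[a,b]$). Then $(\tilde M,L)$ is causally simple if and only if for every pair $(x,y)\in M\times M$ there is a geodesic of $\tilde F$ from $x$ to $y$ whose $\tilde F$-length equals $\tilde d(x,y)$. -/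

import Mathlib

open Set Filter Topology MeasureTheory Manifold
open scoped ContDiff

noncomputable section

namespace FinslerStatic

section General

variable {E : Type*} [NormedAddCommGroup E] [NormedSpace ℝ E]
  {H : Type*} [TopologicalSpace H] (I : ModelWithCorners ℝ E H)
  {N : Type*} [TopologicalSpace N] [ChartedSpace H N]

/-! ### Curves -/

/-- `γ` restricted to `[a, b]` (with `a < b`) is a continuous piecewise smooth curve: it is continuous
on `[a, b]`, and smooth on each closed interval of some finite subdivision of `[a, b]`. -/
def IsPiecewiseSmooth (γ : ℝ → N) (a b : ℝ) : Prop :=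
  a < b ∧ ContinuousOn γ (Icc a b) ∧
    ∃ (k : ℕ) (s : ℕ → ℝ), s 0 = a ∧ s k = b ∧
      ∀ j < k, s j < s (j + 1) ∧ ContMDiffOn 𝓘(ℝ, ℝ) I ∞ γ (Icc (s j) (s (j + 1)))

/-- `γ` belongs to the path space `Ω_{pq}` of curves parametrized on `[a, b]`. -/
def IsPath (γ : ℝ → N) (a b : ℝ) (p q : N) : Prop :=
  IsPiecewiseSmooth I γ a b ∧ γ a = p ∧ γ b = q

/-- The velocity of `γ` at `s`, as a point of the tangent bundle. -/
def velocity (γ : ℝ → N) (s : ℝ) : TangentBundle I N :=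
  ⟨γ s, mfderiv 𝓘(ℝ, ℝ) I γ s (1 : ℝ)⟩

/-- The right derivative of `γ` at `s`. -/
def rightVelocity (γ : ℝ → N) (s : ℝ) : TangentBundle I N :=
  ⟨γ s, mfderivWithin 𝓘(ℝ, ℝ) I γ (Ici s) s (1 : ℝ)⟩

/-- The left derivative of `γ` at `s`. -/
def leftVelocity (γ : ℝ → N) (s : ℝ) : TangentBundle I N :=
  ⟨γ s, mfderivWithin 𝓘(ℝ, ℝ) I γ (Iic s) s (1 : ℝ)⟩

/-- The vertical Hessian `½ ∂²L/∂vⁱ∂vʲ` of a function `L` on the tangent bundle, at the tangent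
vector `w`, evaluated at the vectors `u₁`, `u₂` of the same tangent space. -/
def vertHess (L : TangentBundle I N → ℝ) (w : TangentBundle I N)
    (u₁ u₂ : TangentSpace I w.1) : ℝ :=
  (1 / 2) * iteratedFDeriv ℝ 2 (fun u : E => L ⟨w.1, u⟩) (w.2 : E) ![(u₁ : E), (u₂ : E)]

/-! ### Finsler metrics, length, distance, geodesics -/

/-- `F` is a (not necessarily reversible) Finsler metric. -/
structure IsFinslerMetric [IsManifold I ∞ N] (F : TangentBundle I N → ℝ) : Prop where
  continuous : Continuous F
  smooth : ContMDiffOn I.tangent 𝓘(ℝ, ℝ) ∞ F {v | v.2 ≠ 0}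
  pos : ∀ v : TangentBundle I N, v.2 ≠ 0 → 0 < F v
  homogeneous : ∀ (x : N) (v : TangentSpace I x) (c : ℝ), 0 < c → F ⟨x, c • v⟩ = c * F ⟨x, v⟩
  posDef : ∀ v : TangentBundle I N, v.2 ≠ 0 → ∀ u : TangentSpace I v.1, u ≠ 0 →
    0 < vertHess I (fun w => F w ^ 2) v u u

/-- The `F`-length of `γ` on `[a, b]`. -/
def length (F : TangentBundle I N → ℝ) (γ : ℝ → N) (a b : ℝ) : ℝ :=
  ∫ s in a..b, F (velocity I γ s)

/-- The `F`-energy of `γ` on `[a, b]`. -/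
def energy (F : TangentBundle I N → ℝ) (γ : ℝ → N) (a b : ℝ) : ℝ :=
  (1 / 2) * ∫ s in a..b, F (velocity I γ s) ^ 2

/-- The (in general not symmetric) distance of `F`: the infimum of the lengths of the piecewise
smooth curves from `x` to `y`. -/
def finslerDist (F : TangentBundle I N → ℝ) (x y : N) : ℝ :=
  sInf {ℓ : ℝ | ∃ (γ : ℝ → N) (a b : ℝ), IsPath I γ a b x y ∧ ℓ = length I F γ a b}

/-- `ψ`, on `(-ε, ε) × [a, b]`, is a proper variation of the curve `γ` on `[a, b]`. -/
def IsProperVariation (ψ : ℝ × ℝ → N) (ε : ℝ) (γ : ℝ → N) (a b : ℝ) : Prop :=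
  0 < ε ∧ ContinuousOn ψ (Ioo (-ε) ε ×ˢ Icc a b) ∧
    (∀ s ∈ Icc a b, ψ (0, s) = γ s) ∧
    (∀ r ∈ Ioo (-ε) ε, ψ (r, a) = γ a ∧ ψ (r, b) = γ b) ∧
    ∃ (k : ℕ) (s : ℕ → ℝ), s 0 = a ∧ s k = b ∧
      ∀ j < k, s j < s (j + 1) ∧
        ContMDiffOn 𝓘(ℝ, ℝ × ℝ) I ∞ ψ (Ioo (-ε) ε ×ˢ Icc (s j) (s (j + 1)))

/-- `γ` on `[a, b]` is an (affinely parametrized) geodesic of `F`: a piecewise smooth curve which is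
a critical point of the energy functional for all proper variations. -/
def IsGeodesic (F : TangentBundle I N → ℝ) (γ : ℝ → N) (a b : ℝ) : Prop :=
  IsPiecewiseSmooth I γ a b ∧
    ∀ (ψ : ℝ × ℝ → N) (ε : ℝ), IsProperVariation I ψ ε γ a b →
      HasDerivAt (fun r : ℝ => energy I F (fun s => ψ (r, s)) a b) 0 0

/-! ### Causality of a Finsler function `L`, time-oriented by a vector field `T`

The line bundle along which `L` may fail to be twice differentiable is the one spanned by `T`. -/

variable (L : TangentBundle I N → ℝ) (T : ∀ p : N, TangentSpace I p)

/-- `w` belongs to the line bundle spanned by `T`. -/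
def InLine (w : TangentBundle I N) : Prop :=
  ∃ c : ℝ, w.2 = c • T w.1

def IsTimelikeVec (w : TangentBundle I N) : Prop :=
  (InLine I T w ∧ w.2 ≠ 0) ∨ (¬ InLine I T w ∧ vertHess I L w w.2 w.2 < 0)

def IsLightlikeVec (w : TangentBundle I N) : Prop :=
  ¬ InLine I T w ∧ vertHess I L w w.2 w.2 = 0

def IsCausalVec (w : TangentBundle I N) : Prop :=
  IsTimelikeVec I L T w ∨ IsLightlikeVec I L T w

def IsFuturePointingVec (w : TangentBundle I N) : Prop :=
  (∃ c : ℝ, 0 < c ∧ w.2 = c • T w.1) ∨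
    (¬ InLine I T w ∧ vertHess I L w w.2 (T w.1) < 0)

/-- `γ` on `[a, b]` is a future-pointing causal curve: piecewise smooth, with all its one-sided
derivatives causal and future-pointing. -/
def IsFutureCausalCurve (γ : ℝ → N) (a b : ℝ) : Prop :=
  IsPiecewiseSmooth I γ a b ∧
    (∀ s ∈ Ico a b, IsCausalVec I L T (rightVelocity I γ s) ∧
      IsFuturePointingVec I L T (rightVelocity I γ s)) ∧
    (∀ s ∈ Ioc a b, IsCausalVec I L T (leftVelocity I γ s) ∧
      IsFuturePointingVec I L T (leftVelocity I γ s))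

/-- The causal relation `p ≤ q`: either `p = q`, or there is a future-pointing causal curve
from `p` to `q`. -/
def CausallyRelated (p q : N) : Prop :=
  p = q ∨ ∃ (γ : ℝ → N) (a b : ℝ), IsFutureCausalCurve I L T γ a b ∧ γ a = p ∧ γ b = q

def causalFuture (p : N) : Set N := {q | CausallyRelated I L T p q}

def causalPast (p : N) : Set N := {q | CausallyRelated I L T q p}

/-- Causal simplicity: all the sets `J⁺(p)` and `J⁻(p)` are closed, and there is no closed
future-pointing causal curve. -/
def IsCausallySimple : Prop :=
  (∀ p : N, IsClosed (causalFuture I L T p) ∧ IsClosed (causalPast I L T p)) ∧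
    ¬ ∃ (γ : ℝ → N) (a b : ℝ), IsFutureCausalCurve I L T γ a b ∧ γ a = γ b

end General

/-! ### Standard static Finsler spacetimes -/

section Static

variable {E : Type*} [NormedAddCommGroup E] [NormedSpace ℝ E]
  {H : Type*} [TopologicalSpace H] (I : ModelWithCorners ℝ E H)
  {M : Type*} [TopologicalSpace M] [ChartedSpace H M]

/-- The Finsler function `L(τ, v) = -Λ τ² + F(v)²` on `ℝ × M`. -/
def staticL (Λ : M → ℝ) (F : TangentBundle I M → ℝ) :
    TangentBundle (𝓘(ℝ, ℝ).prod I) (ℝ × M) → ℝ := fun w =>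
  -Λ w.1.2 * ((w.2 : ℝ × E).1) ^ 2 + F ⟨w.1.2, (w.2 : ℝ × E).2⟩ ^ 2

variable (M) in
/-- The vector field `∂_t` on `ℝ × M`. -/
def dt (p : ℝ × M) : TangentSpace (𝓘(ℝ, ℝ).prod I) p := ((1, 0) : ℝ × E)

/-- The metric `F / √Λ` on `M`. -/
def opticalMetric (Λ : M → ℝ) (F : TangentBundle I M → ℝ) : TangentBundle I M → ℝ :=
  fun v => F v / √(Λ v.1)

end Static

end FinslerStatic

end

noncomputable section

namespace FinslerStatic

/-! Write G = F/√Λ for the optical metric and d for its distance. Since L is positively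
2-homogeneous, Euler's relations give g_w(w,w) = L(w) and g_w(w,∂_t) = -Λτ for w = (τ, v) with v ≠
0. So w is causal and future-pointing exactly when τ > 0 and G(v) ≤ τ, and a causal curve is a pair
(t, σ) with t' > 0 and t' ≥ G(σ'). Hence the length of σ is at most the elapsed time
(`length_le_of_causal`). Conversely any curve lifts to a causal curve taking any time larger than
its length (`exists_causal_lift`). So J⁺ of (t₀, x) lies between the sets t₀ + d(x,y) < t₁ and t₀ +
d(x,y) ≤ t₁, and the question is whether the boundary t₁ = t₀ + d(x,y) belongs to it.

If J⁺ is closed, the point (d(x,y), y) is reached from (0, x). Unless x = y, the connecting causal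
curve satisfies d ≤ length ≤ elapsed time = d, so G(σ') = t' everywhere, and σ parametrized by t is
a minimizer of unit speed (`exists_unitSpeed`). Such a curve is energy-critical: g² ≥ 2g - 1 makes
it a minimum of the energy, and the energy is differentiable along variations because G² is smooth
near unit vectors. For x = y the constant curve serves. There G² need not be smooth, but the energy
of a variation is O(r²).

If minimizing geodesics exist, sliding an interior parameter along the curve shows that a geodesic
has constant speed on each smooth piece (`exists_speed_eq`). It therefore lifts to a causal curve
whose elapsed time is exactly its length. So J⁺ and J⁻ are given by t₀ + d ≤ t₁, which is closed
because d is continuous. Closed causal curves are impossible because t strictly increases. -/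

/-! ### Subdivisions of an interval -/

/-- `[a, b]` has a finite subdivision into nontrivial intervals with the property `Q`. -/
def Subdivisible (Q : ℝ → ℝ → Prop) : ℝ → ℝ → Prop :=
  Relation.ReflTransGen fun c d => c < d ∧ Q c d

/-- Replaces indexed breakpoints by an inductive relation: concatenation becomes transitivity and
piecewise arguments become `ReflTransGen` induction. The empty chain forces a = b, which is why
later inductions carry that alternative. -/
theorem exists_subdivision_iff {Q : ℝ → ℝ → Prop} {a b : ℝ} :
    (∃ (k : ℕ) (s : ℕ → ℝ), s 0 = a ∧ s k = b ∧ ∀ j < k, s j < s (j + 1) ∧ Q (s j) (s (j + 1))) ↔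
      Subdivisible Q a b := by
  constructor
  · rintro ⟨k, s, rfl, rfl, h⟩
    induction k with
    | zero => exact Relation.ReflTransGen.refl
    | succ k ih =>
      exact Relation.ReflTransGen.tail (ih fun j hj => h j (by omega)) (h k (by omega))
  · intro h
    induction h with
    | refl => exact ⟨0, fun _ => a, rfl, rfl, by simp⟩
    | @tail c d _ hcd ih =>
      obtain ⟨k, s, h0, hk, h⟩ := ih
      refine ⟨k + 1, Function.update s (k + 1) d, ?_, by simp, fun j hj => ?_⟩
      · rw [Function.update_of_ne (by omega), h0]
      · rw [Function.update_of_ne (by omega)]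
        rcases Nat.lt_succ_iff_lt_or_eq.1 hj with hj | rfl
        · rw [Function.update_of_ne (by omega)]
          exact h j hj
        · rw [Function.update_self, hk]
          exact hcd

namespace Subdivisible

variable {Q R : ℝ → ℝ → Prop} {a b c : ℝ}

theorem single (h : a < b) (hQ : Q a b) : Subdivisible Q a b :=
  Relation.ReflTransGen.single ⟨h, hQ⟩

theorem trans (h₁ : Subdivisible Q a b) (h₂ : Subdivisible Q b c) : Subdivisible Q a c :=
  Relation.ReflTransGen.trans h₁ h₂

theorem mono (hQR : ∀ c d, c < d → Q c d → R c d) (h : Subdivisible Q a b) : Subdivisible R a b :=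
  Relation.ReflTransGen.mono (fun c d hcd => ⟨hcd.1, hQR c d hcd.1 hcd.2⟩) _ _ h

theorem le (h : Subdivisible Q a b) : a ≤ b := by
  induction h with
  | refl => exact le_rfl
  | tail _ h ih => exact ih.trans h.1.le

/-- Lets each piece remember that it is joined to both endpoints. This gives containment in [a, b],
and subdivisions of the remainder when a single piece is modified. -/
theorem bounded (h : Subdivisible Q a b) :
    Subdivisible (fun c d => Q c d ∧ Subdivisible Q a c ∧ Subdivisible Q d b) a b := by
  induction h with
  | refl => exact Relation.ReflTransGen.refl
  | @tail c d hac hcd ih =>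
    refine Relation.ReflTransGen.tail (mono (fun p q _ h => ⟨h.1, h.2.1, h.2.2.tail hcd⟩) ih)
      ⟨hcd.1, hcd.2, hac, Relation.ReflTransGen.refl⟩

end Subdivisible

/-! ### Velocities of curves -/

section Curves

variable {E : Type*} [NormedAddCommGroup E] [NormedSpace ℝ E]
  {H : Type*} [TopologicalSpace H] {I : ModelWithCorners ℝ E H}
  {N : Type*} [TopologicalSpace N] [ChartedSpace H N]
  {γ η : ℝ → N} {a b c d s : ℝ} {S U : Set ℝ}

variable (I) in
/-- The velocity of `γ` at `s` relative to the set `S` of parameters. -/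
def velocityWithin (γ : ℝ → N) (S : Set ℝ) (s : ℝ) : TangentBundle I N :=
  ⟨γ s, mfderivWithin 𝓘(ℝ, ℝ) I γ S s (1 : ℝ)⟩

theorem velocityWithin_univ : velocityWithin I γ univ s = velocity I γ s := by
  simp [velocityWithin, velocity, mfderivWithin_univ]

theorem velocityWithin_congr_set (h : S =ᶠ[𝓝 s] U) :
    velocityWithin I γ S s = velocityWithin I γ U s := by
  simp only [velocityWithin, mfderivWithin_congr_set h]

theorem velocityWithin_of_mem_nhds (h : S ∈ 𝓝 s) : velocityWithin I γ S s = velocity I γ s := by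
  rw [← velocityWithin_univ]
  exact velocityWithin_congr_set (by simpa using h)

theorem velocityWithin_Icc (hs : s ∈ Ioo c d) :
    velocityWithin I γ (Icc c d) s = velocity I γ s :=
  velocityWithin_of_mem_nhds (Icc_mem_nhds hs.1 hs.2)

theorem velocityWithin_congr (h : EqOn γ η S) (hs : s ∈ S) :
    velocityWithin I γ S s = velocityWithin I η S s := by
  have h1 : mfderivWithin 𝓘(ℝ, ℝ) I γ S s = mfderivWithin 𝓘(ℝ, ℝ) I η S s :=
    mfderivWithin_congr h (h hs)
  have h2 := h hs
  simp only [velocityWithin]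
  rw [h1]
  revert h2
  -- The tangent spaces over `γ s` and `η s` are both E by definition, so once the base points agree
  -- the fibre components agree by `rfl`.
  generalize (mfderivWithin 𝓘(ℝ, ℝ) I η S s) = L
  intro h2
  exact Bundle.TotalSpace.ext h2 (by rfl)

theorem velocity_congr (h : γ =ᶠ[𝓝 s] η) : velocity I γ s = velocity I η s := by
  obtain ⟨U, hU, hγ⟩ := h.exists_mem
  rw [← velocityWithin_of_mem_nhds hU, ← velocityWithin_of_mem_nhds hU,
    velocityWithin_congr hγ (mem_of_mem_nhds hU)]

theorem velocityWithin_subset (hUS : U ⊆ S) (hU : UniqueDiffWithinAt ℝ U s)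
    (h : MDifferentiableWithinAt 𝓘(ℝ, ℝ) I γ S s) :
    velocityWithin I γ U s = velocityWithin I γ S s := by
  simp only [velocityWithin, mfderivWithin_subset hUS hU.uniqueMDiffWithinAt h]

/-- The interval [s, d] lies in [c, d] and has the same germ at s as the ray [s, ∞). This identifies
the one-sided velocities of the causality conditions with derivatives within a closed smooth piece.
-/
theorem rightVelocity_eq (hs : s ∈ Ico c d)
    (h : MDifferentiableWithinAt 𝓘(ℝ, ℝ) I γ (Icc c d) s) :
    rightVelocity I γ s = velocityWithin I γ (Icc c d) s := by
  change velocityWithin I γ (Ici s) s = _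
  rw [← velocityWithin_subset (Icc_subset_Icc_left hs.1) (uniqueDiffOn_Icc hs.2 s ⟨le_rfl, hs.2.le⟩) h]
  exact velocityWithin_congr_set
    (by filter_upwards [Iio_mem_nhds hs.2] with x hx; exact propext ⟨fun h => ⟨h, le_of_lt hx⟩, fun h => h.1⟩)

theorem leftVelocity_eq (hs : s ∈ Ioc c d)
    (h : MDifferentiableWithinAt 𝓘(ℝ, ℝ) I γ (Icc c d) s) :
    leftVelocity I γ s = velocityWithin I γ (Icc c d) s := by
  change velocityWithin I γ (Iic s) s = _
  rw [← velocityWithin_subset (Icc_subset_Icc_right hs.2) (uniqueDiffOn_Icc hs.1 s ⟨hs.1.le, le_rfl⟩) h]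
  exact velocityWithin_congr_set
    (by filter_upwards [Ioi_mem_nhds hs.1] with x hx; exact propext ⟨fun h => ⟨le_of_lt hx, h⟩, fun h => h.2⟩)

theorem velocityWithin_comp {u : ℝ → ℝ} {u' : ℝ}
    (hγ : MDifferentiableWithinAt 𝓘(ℝ, ℝ) I γ S (u s)) (hu : HasDerivWithinAt u u' U s)
    (hUS : MapsTo u U S) (hU : UniqueDiffWithinAt ℝ U s) :
    velocityWithin I (γ ∘ u) U s =
      ⟨γ (u s), u' • (velocityWithin I γ S (u s)).2⟩ := by
  have h1 : HasMFDerivWithinAt 𝓘(ℝ, ℝ) 𝓘(ℝ, ℝ) u U s (ContinuousLinearMap.smulRight (1 : ℝ →L[ℝ] ℝ) u') :=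
    hu.hasFDerivWithinAt.hasMFDerivWithinAt
  have h2 := (hγ.hasMFDerivWithinAt.comp s h1 hUS).mfderivWithin hU.uniqueMDiffWithinAt
  simp only [velocityWithin]
  rw [h2]
  have key : ∀ A : ℝ →L[ℝ] E,
      (A.comp (ContinuousLinearMap.smulRight (1 : ℝ →L[ℝ] ℝ) u')) 1 = u' • A 1 := fun A => by
    rw [← map_smul]
    simp
  exact congrArg (fun v : E => (⟨γ (u s), v⟩ : TangentBundle I N)) (key _)

variable [IsManifold I ∞ N]

theorem continuousOn_velocityWithin (hcd : c < d) (h : ContMDiffOn 𝓘(ℝ, ℝ) I ∞ γ (Icc c d)) :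
    ContinuousOn (velocityWithin I γ (Icc c d)) (Icc c d) := by
  have h1 := h.continuousOn_tangentMapWithin (by simp) (uniqueDiffOn_Icc hcd).uniqueMDiffOn
  have h2 : Continuous fun s : ℝ => (⟨s, (1 : ℝ)⟩ : TangentBundle 𝓘(ℝ, ℝ) ℝ) := by
    have : ContMDiff 𝓘(ℝ, ℝ) 𝓘(ℝ, ℝ).tangent ∞
        fun s : ℝ => (⟨s, (1 : ℝ)⟩ : TangentBundle 𝓘(ℝ, ℝ) ℝ) :=
      contMDiff_vectorSpace_iff_contDiff.2 contDiff_const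
    exact this.continuous
  exact h1.comp h2.continuousOn fun s hs => hs

end Curves

theorem Subdivisible.map {Q R : ℝ → ℝ → Prop} {a b : ℝ} (u : ℝ → ℝ) (h : Subdivisible Q a b)
    (huv : ∀ c d, c < d → Q c d → u c < u d ∧ R (u c) (u d)) : Subdivisible R (u a) (u b) :=
  Relation.ReflTransGen.lift u (fun c d hcd => huv c d hcd.1 hcd.2) _ _ h

section Curves

variable {E : Type*} [NormedAddCommGroup E] [NormedSpace ℝ E]
  {H : Type*} [TopologicalSpace H] {I : ModelWithCorners ℝ E H}
  {N : Type*} [TopologicalSpace N] [ChartedSpace H N]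
  {γ η : ℝ → N} {a b c d s : ℝ} {x y z : N}

/-! ### Piecewise smooth curves -/

namespace IsPiecewiseSmooth

theorem subdivisible (h : IsPiecewiseSmooth I γ a b) :
    Subdivisible (fun c d => ContMDiffOn 𝓘(ℝ, ℝ) I ∞ γ (Icc c d)) a b :=
  exists_subdivision_iff.1 h.2.2

theorem of_subdivisible (hab : a < b)
    (h : Subdivisible (fun c d => ContMDiffOn 𝓘(ℝ, ℝ) I ∞ γ (Icc c d)) a b) :
    IsPiecewiseSmooth I γ a b := by
  refine ⟨hab, ?_, exists_subdivision_iff.2 h⟩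
  clear hab
  induction h with
  | refl => simp
  | @tail c d hac hcd ih =>
    rw [← Icc_union_Icc_eq_Icc (Subdivisible.le hac) hcd.1.le]
    exact ih.union_of_isClosed hcd.2.continuousOn isClosed_Icc isClosed_Icc

theorem of_contMDiffOn (hab : a < b) (h : ContMDiffOn 𝓘(ℝ, ℝ) I ∞ γ (Icc a b)) :
    IsPiecewiseSmooth I γ a b :=
  of_subdivisible hab (Subdivisible.single hab h)

theorem trans (h₁ : IsPiecewiseSmooth I γ a b) (h₂ : IsPiecewiseSmooth I γ b c) :
    IsPiecewiseSmooth I γ a c :=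
  of_subdivisible (h₁.1.trans h₂.1) (h₁.subdivisible.trans h₂.subdivisible)

theorem congr (h : IsPiecewiseSmooth I γ a b) (hη : EqOn η γ (Icc a b)) :
    IsPiecewiseSmooth I η a b :=
  of_subdivisible h.1 <| h.subdivisible.bounded.mono fun _ _ _ hQ =>
    hQ.1.congr fun _ hs => hη ⟨hQ.2.1.le.trans hs.1, hs.2.trans hQ.2.2.le⟩

/-- Properties that pass to concatenations need checking only on smooth pieces. P is never asked
about a degenerate interval. -/
theorem induction {P : ℝ → ℝ → Prop} (h : IsPiecewiseSmooth I γ a b)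
    (base : ∀ c d, a ≤ c → c < d → d ≤ b → ContMDiffOn 𝓘(ℝ, ℝ) I ∞ γ (Icc c d) → P c d)
    (tail : ∀ c d, IsPiecewiseSmooth I γ a c → IsPiecewiseSmooth I γ c d →
      P a c → P c d → P a d) : P a b := by
  have key : ∀ b', Subdivisible (fun c d => a ≤ c ∧ d ≤ b ∧ ContMDiffOn 𝓘(ℝ, ℝ) I ∞ γ (Icc c d))
      a b' → a = b' ∨ (IsPiecewiseSmooth I γ a b' ∧ P a b') := fun b' hb' => by
    induction hb' with
    | refl => exact Or.inl rfl
    | @tail c d _ hcd ih =>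
      right
      have hcd' := of_contMDiffOn hcd.1 hcd.2.2.2
      have hP := base c d hcd.2.1 hcd.1 hcd.2.2.1 hcd.2.2.2
      rcases ih with rfl | hac
      · exact ⟨hcd', hP⟩
      · exact ⟨hac.1.trans hcd', tail c d hac.1 hcd' hac.2 hP⟩
  exact ((key b (h.subdivisible.bounded.mono fun c d _ hQ =>
    ⟨hQ.2.1.le, hQ.2.2.le, hQ.1⟩)).resolve_left h.1.ne).2

theorem comp_add_right (h : IsPiecewiseSmooth I γ a b) (δ : ℝ) :
    IsPiecewiseSmooth I (γ ∘ (· + δ)) (a - δ) (b - δ) := by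
  refine of_subdivisible (by linarith [h.1]) (h.subdivisible.map (· - δ) fun c d hcd hQ =>
    ⟨by simpa using hcd, hQ.comp ?_ fun s hs => ?_⟩)
  · rw [contMDiffOn_iff_contDiffOn]
    fun_prop
  · exact ⟨by linarith [hs.1], by linarith [hs.2]⟩

end IsPiecewiseSmooth

theorem IsPath.exists_trans (h₁ : IsPath I γ a b x y) (h₂ : IsPath I η b c y z) :
    ∃ ζ : ℝ → N, IsPath I ζ a c x z ∧ EqOn ζ γ (Iic b) ∧ EqOn ζ η (Ici b) := by
  classical
  obtain ⟨ζ, hζ⟩ : ∃ ζ : ℝ → N, ζ = fun s => if s ≤ b then γ s else η s := ⟨_, rfl⟩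
  have e₁ : EqOn ζ γ (Iic b) := fun s hs => by rw [hζ]; exact if_pos hs
  have e₂ : EqOn ζ η (Ici b) := fun s hs => by
    rcases (mem_Ici.1 hs).eq_or_lt with rfl | hs
    · rw [e₁ self_mem_Iic, h₁.2.2, h₂.2.1]
    · rw [hζ]; exact if_neg (not_le.2 hs)
  refine ⟨ζ, ⟨(h₁.1.congr fun s hs => e₁ hs.2).trans (h₂.1.congr fun s hs => e₂ hs.1), ?_, ?_⟩,
    e₁, e₂⟩
  · rw [e₁ h₁.1.1.le, h₁.2.1]
  · rw [e₂ h₂.1.1.le, h₂.2.2]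

theorem IsPath.comp_add_right (h : IsPath I γ a b x y) (δ : ℝ) :
    IsPath I (γ ∘ (· + δ)) (a - δ) (b - δ) x y :=
  ⟨h.1.comp_add_right δ, by simp [h.2.1], by simp [h.2.2]⟩

theorem isPath_const (hab : a < b) : IsPath I (fun _ => x) a b x x :=
  ⟨.of_contMDiffOn hab contMDiffOn_const, rfl, rfl⟩

theorem velocity_const : velocity I (fun _ => x) s = ⟨x, 0⟩ := by
  have h : mfderiv 𝓘(ℝ, ℝ) I (fun _ : ℝ => x) s = 0 := mfderiv_const
  have h' : ∀ A : ℝ →L[ℝ] E, A = 0 → A 1 = 0 := by rintro _ rfl; rfl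
  exact congrArg (fun v : E => (⟨x, v⟩ : TangentBundle I N)) (h' _ h)

/-! ### Lengths -/

/-- At the ends of a smooth piece the two-sided derivative may not exist, and `mfderiv` is then 0.
The ends are null, so the integrand can be replaced by one defined from the closed piece. -/
theorem integral_velocity_eq {f : TangentBundle I N → ℝ} (hcd : c ≤ d) :
    ∫ s in c..d, f (velocity I γ s) = ∫ s in c..d, f (velocityWithin I γ (Icc c d) s) := by
  rw [intervalIntegral.integral_of_le hcd, intervalIntegral.integral_of_le hcd,
    integral_Ioc_eq_integral_Ioo, integral_Ioc_eq_integral_Ioo]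
  exact setIntegral_congr_fun measurableSet_Ioo fun s hs => by simp only [velocityWithin_Icc hs]

theorem integral_velocity_congr {f : TangentBundle I N → ℝ} (hcd : c ≤ d)
    (h : EqOn γ η (Ioo c d)) :
    ∫ s in c..d, f (velocity I γ s) = ∫ s in c..d, f (velocity I η s) := by
  rw [intervalIntegral.integral_of_le hcd, intervalIntegral.integral_of_le hcd,
    integral_Ioc_eq_integral_Ioo, integral_Ioc_eq_integral_Ioo]
  refine setIntegral_congr_fun measurableSet_Ioo fun s hs => ?_
  rw [velocity_congr (h.eventuallyEq_of_mem (Ioo_mem_nhds hs.1 hs.2))]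

theorem velocity_comp_add_right (δ : ℝ) :
    velocity I (γ ∘ (· + δ)) s = velocity I γ (s + δ) := by
  have key : ∀ (ζ : ℝ → N) (ε r : ℝ), MDifferentiableAt 𝓘(ℝ, ℝ) I ζ (r + ε) →
      MDifferentiableAt 𝓘(ℝ, ℝ) I (ζ ∘ (· + ε)) r := fun ζ ε r hζ =>
    MDifferentiableAt.comp r hζ (differentiableAt_id.add_const ε).mdifferentiableAt
  by_cases h : MDifferentiableAt 𝓘(ℝ, ℝ) I γ (s + δ)
  · have h1 := velocityWithin_comp (S := univ) (U := univ) (u := (· + δ)) (s := s)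
      (mdifferentiableWithinAt_univ.2 h) ((hasDerivWithinAt_id s univ).add_const δ)
      (mapsTo_univ _ _) uniqueDiffWithinAt_univ
    rw [velocityWithin_univ, velocityWithin_univ, one_smul] at h1
    exact h1
  -- Shifting back by -δ shows that differentiability fails on both sides together, and then both
  -- derivatives take the default value 0.
  · have h' : ¬ MDifferentiableAt 𝓘(ℝ, ℝ) I (γ ∘ (· + δ)) s := fun h' => h <| by
      have := key _ (-δ) (s + δ) (by simpa using h')
      simpa [Function.comp_def] using this
    have h1 := mfderiv_zero_of_not_mdifferentiableAt h
    have h2 := mfderiv_zero_of_not_mdifferentiableAt h'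
    have h3 : ∀ A B : ℝ →L[ℝ] E, A = 0 → B = 0 → A 1 = B 1 := by rintro _ _ rfl rfl; rfl
    exact congrArg (fun v : E => (⟨γ (s + δ), v⟩ : TangentBundle I N)) (h3 _ _ h2 h1)

theorem length_comp_add_right (G : TangentBundle I N → ℝ) (δ : ℝ) :
    length I G (γ ∘ (· + δ)) (a - δ) (b - δ) = length I G γ a b := by
  simp only [length, velocity_comp_add_right]
  rw [intervalIntegral.integral_comp_add_right (fun s => G (velocity I γ s))]
  simp

/-- The existence of some path has to be supplied: the infimum of the empty set is 0 by convention,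
so a bound on `finslerDist` alone yields no curve. -/
theorem exists_length_lt {T : ℝ} (h : ∃ (γ : ℝ → N) (a b : ℝ), IsPath I γ a b x y)
    {G : TangentBundle I N → ℝ} (hT : finslerDist I G x y < T) :
    ∃ (γ : ℝ → N) (a b : ℝ), IsPath I γ a b x y ∧ length I G γ a b < T := by
  obtain ⟨γ, a, b, hγ⟩ := h
  obtain ⟨_, ⟨γ, a, b, h, rfl⟩, hlt⟩ := exists_lt_of_csInf_lt (s := {ℓ : ℝ | ∃ (γ : ℝ → N) (a b : ℝ), IsPath I γ a b x y ∧ ℓ = length I G γ a b})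
    ⟨_, γ, a, b, hγ, rfl⟩ hT
  exact ⟨γ, a, b, h, hlt⟩

variable [IsManifold I ∞ N]

theorem IsPiecewiseSmooth.intervalIntegrable {f : TangentBundle I N → ℝ} (hf : Continuous f)
    (h : IsPiecewiseSmooth I γ a b) :
    IntervalIntegrable (fun s => f (velocity I γ s)) volume a b := by
  refine h.induction (fun c d _ hcd _ hγ => ?_) fun c d _ _ h₁ h₂ => h₁.trans h₂
  have h1 : IntervalIntegrable (fun s => f (velocityWithin I γ (Icc c d) s)) volume c d := by
    refine ContinuousOn.intervalIntegrable ?_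
    rw [uIcc_of_le hcd.le]
    exact hf.comp_continuousOn (continuousOn_velocityWithin hcd hγ)
  rw [intervalIntegrable_iff_integrableOn_Ioo_of_le hcd.le] at h1 ⊢
  exact h1.congr_fun (fun s hs => by simp only [velocityWithin_Icc hs]) measurableSet_Ioo

variable (I) in
/-- A continuous positively homogeneous function on the tangent bundle which is positive and smooth
off the zero section. -/
structure IsHomogeneousMetric (G : TangentBundle I N → ℝ) : Prop where
  continuous : Continuous G
  smooth : ContMDiffOn I.tangent 𝓘(ℝ, ℝ) ∞ G {v | v.2 ≠ 0}
  pos : ∀ v : TangentBundle I N, v.2 ≠ 0 → 0 < G v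
  homogeneous : ∀ (x : N) (v : TangentSpace I x) (c : ℝ), 0 < c → G ⟨x, c • v⟩ = c * G ⟨x, v⟩

variable {G : TangentBundle I N → ℝ}

namespace IsHomogeneousMetric

theorem map_zero (hG : IsHomogeneousMetric I G) (x : N) : G ⟨x, 0⟩ = 0 := by
  have h := hG.homogeneous x 0 2 two_pos
  rw [smul_zero] at h
  linarith

theorem nonneg (hG : IsHomogeneousMetric I G) (v : TangentBundle I N) : 0 ≤ G v := by
  by_cases hv : v.2 = 0
  · have : v = ⟨v.1, 0⟩ := by rw [← hv]
    rw [this, hG.map_zero]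
  · exact (hG.pos v hv).le

theorem eq_zero (hG : IsHomogeneousMetric I G) {v : TangentBundle I N} (hv : G v = 0) :
    v.2 = 0 := by
  by_contra h
  exact (hG.pos v h).ne' hv

theorem smul (hG : IsHomogeneousMetric I G) {c : ℝ} (hc : 0 ≤ c) (x : N) (v : TangentSpace I x) :
    G ⟨x, c • v⟩ = c * G ⟨x, v⟩ := by
  rcases hc.eq_or_lt with rfl | hc
  · rw [zero_smul, hG.map_zero, zero_mul]
  · exact hG.homogeneous x v c hc

theorem length_nonneg (hG : IsHomogeneousMetric I G) (hab : a ≤ b) : 0 ≤ length I G γ a b :=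
  intervalIntegral.integral_nonneg hab fun _ _ => hG.nonneg _

theorem length_const (hG : IsHomogeneousMetric I G) : length I G (fun _ => x) a b = 0 := by
  simp [length, velocity_const, hG.map_zero]

theorem length_add (hG : IsHomogeneousMetric I G) (h₁ : IsPiecewiseSmooth I γ a b)
    (h₂ : IsPiecewiseSmooth I γ b c) :
    length I G γ a b + length I G γ b c = length I G γ a c :=
  intervalIntegral.integral_add_adjacent_intervals (h₁.intervalIntegrable hG.continuous)
    (h₂.intervalIntegrable hG.continuous)

theorem finslerDist_le (hG : IsHomogeneousMetric I G) (h : IsPath I γ a b x y) :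
    finslerDist I G x y ≤ length I G γ a b := by
  refine csInf_le ⟨0, ?_⟩ ⟨γ, a, b, h, rfl⟩
  rintro _ ⟨γ, a, b, h, rfl⟩
  exact hG.length_nonneg h.1.1.le

theorem finslerDist_nonneg (hG : IsHomogeneousMetric I G) : 0 ≤ finslerDist I G x y := by
  refine Real.sInf_nonneg ?_
  rintro _ ⟨γ, a, b, h, rfl⟩
  exact hG.length_nonneg h.1.1.le

theorem finslerDist_self (hG : IsHomogeneousMetric I G) : finslerDist I G x x = 0 :=
  le_antisymm ((hG.finslerDist_le (isPath_const one_pos)).trans_eq hG.length_const)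
    hG.finslerDist_nonneg

end IsHomogeneousMetric

theorem IsHomogeneousMetric.exists_path_trans (hG : IsHomogeneousMetric I G)
    (h₁ : IsPath I γ a b x y) (h₂ : IsPath I η c d y z) :
    ∃ (ζ : ℝ → N) (e : ℝ), IsPath I ζ a e x z ∧
      length I G ζ a e = length I G γ a b + length I G η c d := by
  have h₂' := h₂.comp_add_right (c - b)
  obtain ⟨ζ, hζ, e₁, e₂⟩ := h₁.exists_trans (η := η ∘ (· + (c - b)))
    (c := d - (c - b)) (by simpa using h₂')
  have hcd : b < d - (c - b) := by linarith [h₂.1.1]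
  have hb : c - (c - b) = b := by ring
  rw [hb] at h₂'
  refine ⟨ζ, _, hζ, ?_⟩
  rw [← hG.length_add (h₁.1.congr fun s hs => e₁ hs.2) (h₂'.1.congr fun s hs => e₂ hs.1)]
  congr 1
  · exact integral_velocity_congr h₁.1.1.le fun s hs => e₁ hs.2.le
  · rw [← length_comp_add_right (γ := η) G (c - b), hb]
    exact integral_velocity_congr hcd.le fun s hs => e₂ hs.1.le

end Curves

section Distance

variable {E : Type*} [NormedAddCommGroup E] [NormedSpace ℝ E]
  {H : Type*} [TopologicalSpace H] {I : ModelWithCorners ℝ E H}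
  {N : Type*} [TopologicalSpace N] [ChartedSpace H N] [IsManifold I ∞ N]
  {G : TangentBundle I N → ℝ}

/-! ### The distance of a homogeneous metric -/

omit [IsManifold I ∞ N] in
theorem velocityWithin_comp_eq_tangentMapWithin {V : Type*} [NormedAddCommGroup V]
    [NormedSpace ℝ V] {f : V → N} {T : Set V} {u : ℝ → V} {u' : V}
    {S : Set ℝ} {s : ℝ} (hf : MDifferentiableWithinAt 𝓘(ℝ, V) I f T (u s))
    (hu : HasDerivWithinAt u u' S s) (hmaps : MapsTo u S T) (hS : UniqueDiffWithinAt ℝ S s) :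
    velocityWithin I (f ∘ u) S s = tangentMapWithin 𝓘(ℝ, V) I f T ⟨u s, u'⟩ := by
  have h1 : HasMFDerivWithinAt 𝓘(ℝ, ℝ) 𝓘(ℝ, V) u S s
      (ContinuousLinearMap.smulRight (1 : ℝ →L[ℝ] ℝ) u') :=
    hu.hasFDerivWithinAt.hasMFDerivWithinAt
  have h2 := (hf.hasMFDerivWithinAt.comp s h1 hmaps).mfderivWithin hS.uniqueMDiffWithinAt
  have key : ∀ A : V →L[ℝ] E,
      (A.comp (ContinuousLinearMap.smulRight (1 : ℝ →L[ℝ] ℝ) u')) 1 = A u' := fun A => by simp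
  have h3 := key (mfderivWithin 𝓘(ℝ, V) I f T (u s))
  exact congrArg (fun w : E => (⟨f (u s), w⟩ : TangentBundle I N))
    ((congrArg (fun A : ℝ →L[ℝ] E => A 1) h2).trans h3)

namespace IsHomogeneousMetric

/-- In a chart, a homogeneous metric is locally bounded by a multiple of the norm. -/
theorem exists_chart_bound [I.Boundaryless] (hG : IsHomogeneousMetric I G) (y : N) :
    ∃ C δ : ℝ, 0 ≤ C ∧ 0 < δ ∧ ∀ p ∈ Metric.ball (extChartAt I y y) δ,
      p ∈ (extChartAt I y).target ∧ ∀ v : E, G (tangentMapWithin 𝓘(ℝ, E) I (extChartAt I y).symm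
        (extChartAt I y).target ⟨p, v⟩) ≤ C * ‖v‖ := by
  set φ := extChartAt I y with hφ
  have hT : IsOpen φ.target := isOpen_extChartAt_target y
  have hf : ContMDiffOn 𝓘(ℝ, E) I ∞ φ.symm φ.target := contMDiffOn_extChartAt_symm y
  have h1 := hf.continuousOn_tangentMapWithin (by simp) hT.uniqueDiffOn.uniqueMDiffOn
  have h2 : Continuous fun z : E × E => (⟨z.1, z.2⟩ : TangentBundle 𝓘(ℝ, E) E) :=
    (tangentBundleModelSpaceHomeomorph 𝓘(ℝ, E)).symm.continuous
  have h3 : ContinuousOn (fun z : E × E => G (tangentMapWithin 𝓘(ℝ, E) I φ.symm φ.target ⟨z.1, z.2⟩))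
      (φ.target ×ˢ univ) :=
    hG.continuous.comp_continuousOn (h1.comp h2.continuousOn fun z hz => hz.1)
  have hy : φ y ∈ φ.target := φ.map_source (mem_extChartAt_source y)
  have h4 := (h3 (φ y, 0) ⟨hy, mem_univ _⟩).continuousAt
    ((hT.prod isOpen_univ).mem_nhds ⟨hy, mem_univ _⟩)
  have hsmul : ∀ (p v : E) (c : ℝ), 0 ≤ c →
      G (tangentMapWithin 𝓘(ℝ, E) I φ.symm φ.target ⟨p, c • v⟩) =
        c * G (tangentMapWithin 𝓘(ℝ, E) I φ.symm φ.target ⟨p, v⟩) := fun p v c hc => by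
    have key : ∀ A : E →L[ℝ] E, A (c • v) = c • A v := fun A => map_smul A c v
    have := key (mfderivWithin 𝓘(ℝ, E) I φ.symm φ.target p)
    exact (congrArg (fun v : E => G ⟨φ.symm p, v⟩) this).trans (hG.smul hc _ _)
  have h5 : ∀ p, G (tangentMapWithin 𝓘(ℝ, E) I φ.symm φ.target ⟨p, (0 : E)⟩) = 0 := fun p => by
    simpa using hsmul p 0 0 le_rfl
  -- G vanishes on zero vectors, so by continuity it is below 1 for base points and vectors within
  -- δ. Rescaling any nonzero vector to norm δ/2 turns this into the bound with constant 2/δ.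
  have h6 := h4.eventually_lt (continuousAt_const (y := (1 : ℝ))) (by simp only [h5]; exact one_pos)
  obtain ⟨δ, hδ, h7⟩ := Metric.eventually_nhds_iff_ball.1 (h6.and
    ((hT.prod isOpen_univ).mem_nhds ⟨hy, mem_univ _⟩))
  refine ⟨2 / δ, δ, by positivity, hδ, fun p hp => ⟨(h7 (p, 0) ?_).2.1, fun v => ?_⟩⟩
  · rw [← ball_prod_same]
    exact ⟨hp, Metric.mem_ball_self hδ⟩
  · rcases eq_or_ne v 0 with rfl | hv
    · rw [h5, norm_zero, mul_zero]
    · have hc : 0 < 2 / δ * ‖v‖ := mul_pos (by positivity) (norm_pos_iff.2 hv)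
      have h8 := (h7 (p, (2 / δ * ‖v‖)⁻¹ • v) (by
        rw [← ball_prod_same]
        refine ⟨hp, mem_ball_zero_iff.2 ?_⟩
        rw [norm_smul, norm_inv, Real.norm_of_nonneg hc.le, mul_inv, mul_assoc,
          inv_mul_cancel₀ (norm_pos_iff.2 hv).ne', mul_one, inv_div]
        linarith)).1
      have h9 := hsmul p ((2 / δ * ‖v‖)⁻¹ • v) _ hc.le
      rw [smul_inv_smul₀ hc.ne'] at h9
      rw [h9]
      exact mul_le_of_le_one_right hc.le h8.le

/-- A straight segment inside a chart ball of radius ρ has coordinate velocity at most 2ρ, hence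
length at most 2Cρ. The ordered pair (p, q) is arbitrary in U, so both directions are covered
although G need not be reversible. -/
theorem exists_nhds_path_length_lt [I.Boundaryless] (hG : IsHomogeneousMetric I G) (y : N) {ε : ℝ}
    (hε : 0 < ε) :
    ∃ U ∈ 𝓝 y, ∀ p ∈ U, ∀ q ∈ U, ∃ γ : ℝ → N, IsPath I γ 0 1 p q ∧ length I G γ 0 1 < ε := by
  obtain ⟨C, δ, hC, hδ, h8⟩ := hG.exists_chart_bound y
  set φ := extChartAt I y with hφ
  have hf : ContMDiffOn 𝓘(ℝ, E) I ∞ φ.symm φ.target := contMDiffOn_extChartAt_symm y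
  obtain ⟨ρ, hρ, hρδ, hρε⟩ : ∃ ρ > 0, ρ ≤ δ ∧ C * (2 * ρ) < ε := by
    refine ⟨min δ (ε / (4 * (C + 1))), lt_min hδ (by positivity), min_le_left _ _, ?_⟩
    have h1 : (C + 1) * (2 * min δ (ε / (4 * (C + 1)))) ≤ (C + 1) * (2 * (ε / (4 * (C + 1)))) := by
      gcongr
      exact min_le_right _ _
    have h2 : (C + 1) * (2 * (ε / (4 * (C + 1)))) = ε / 2 := by field_simp; ring
    have h3 : 0 < min δ (ε / (4 * (C + 1))) := lt_min hδ (by positivity)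
    linarith
  refine ⟨φ.source ∩ φ ⁻¹' Metric.ball (φ y) ρ, inter_mem (extChartAt_source_mem_nhds y)
    ((continuousAt_extChartAt y).preimage_mem_nhds (Metric.ball_mem_nhds _ hρ)), ?_⟩
  rintro p ⟨hp, hp'⟩ q ⟨hq, hq'⟩
  set v := φ q - φ p with hv
  have hvρ : ‖v‖ ≤ 2 * ρ := by
    rw [hv, ← dist_eq_norm]
    have h1 : dist (φ q) (φ y) < ρ := hq'
    have h2 : dist (φ p) (φ y) < ρ := hp'
    linarith [dist_triangle_right (φ q) (φ p) (φ y)]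
  have hu : ∀ s ∈ Icc (0 : ℝ) 1, φ p + s • v ∈ Metric.ball (φ y) δ := fun s hs =>
    Metric.ball_subset_ball hρδ ((convex_ball (φ y) ρ).add_smul_sub_mem hp' hq' hs)
  have hmaps : MapsTo (fun s : ℝ => φ p + s • v) (Icc 0 1) φ.target := fun s hs => (h8 _ (hu s hs)).1
  have hsm : ContMDiffOn 𝓘(ℝ, ℝ) I ∞ (φ.symm ∘ fun s : ℝ => φ p + s • v) (Icc 0 1) := by
    refine hf.comp (t := φ.target) (f := fun s : ℝ => φ p + s • v) ?_ hmaps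
    rw [contMDiffOn_iff_contDiffOn]
    fun_prop
  refine ⟨φ.symm ∘ fun s => φ p + s • v, ⟨.of_contMDiffOn one_pos hsm, ?_, ?_⟩, ?_⟩
  · simp [φ.left_inv hp]
  · simp [hv, φ.left_inv hq]
  · have hvel : ∀ s ∈ Icc (0 : ℝ) 1,
        velocityWithin I (φ.symm ∘ fun s : ℝ => φ p + s • v) (Icc 0 1) s =
          tangentMapWithin 𝓘(ℝ, E) I φ.symm φ.target ⟨φ p + s • v, v⟩ := fun s hs => by
      have : HasDerivAt (fun s : ℝ => φ p + s • v) v s := by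
        simpa using ((hasDerivAt_id s).smul_const v).const_add (φ p)
      exact velocityWithin_comp_eq_tangentMapWithin ((hf.mdifferentiableOn (by simp)) _ (hmaps hs))
        this.hasDerivWithinAt hmaps (uniqueDiffOn_Icc one_pos s hs)
    have := intervalIntegral.norm_integral_le_of_norm_le_const (a := 0) (b := 1) (C := C * (2 * ρ))
      (f := fun s => G (velocityWithin I (φ.symm ∘ fun s : ℝ => φ p + s • v) (Icc 0 1) s))
      fun s hs => by
        rw [uIoc_of_le zero_le_one] at hs
        have hs' : s ∈ Icc (0 : ℝ) 1 := ⟨hs.1.le, hs.2⟩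
        rw [Real.norm_of_nonneg (hG.nonneg _), hvel s hs']
        exact ((h8 _ (hu s hs')).2 v).trans (by gcongr)
    rw [length, integral_velocity_eq zero_le_one]
    calc _ ≤ _ := Real.le_norm_self _
      _ ≤ _ := this
      _ < ε := by simpa using hρε

/-- The set of points reachable from x is open and closed, since sufficiently close points are
joined in both directions. -/
theorem exists_isPath [I.Boundaryless] [PreconnectedSpace N] (hG : IsHomogeneousMetric I G)
    (x y : N) : ∃ (γ : ℝ → N) (a b : ℝ), IsPath I γ a b x y := by
  have key : IsClopen {y | ∃ (γ : ℝ → N) (a b : ℝ), IsPath I γ a b x y} := by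
    refine ⟨isOpen_compl_iff.1 (isOpen_iff_mem_nhds.2 fun y hy => ?_),
      isOpen_iff_mem_nhds.2 fun y hy => ?_⟩
    all_goals
      obtain ⟨U, hU, h⟩ := hG.exists_nhds_path_length_lt y one_pos
      filter_upwards [hU] with z hz
    · rintro ⟨γ, a, b, hγ⟩
      obtain ⟨η, hη, -⟩ := h z hz y (mem_of_mem_nhds hU)
      obtain ⟨ζ, e, hζ, -⟩ := hG.exists_path_trans hγ hη
      exact hy ⟨ζ, a, e, hζ⟩
    · obtain ⟨γ, a, b, hγ⟩ := hy
      obtain ⟨η, hη, -⟩ := h y (mem_of_mem_nhds hU) z hz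
      obtain ⟨ζ, e, hζ, -⟩ := hG.exists_path_trans hγ hη
      exact ⟨ζ, a, e, hζ⟩
  have := key.eq_univ ⟨x, _, 0, 1, isPath_const one_pos⟩
  exact this.ge (mem_univ y)

variable [I.Boundaryless] [PreconnectedSpace N]

theorem finslerDist_triangle (hG : IsHomogeneousMetric I G) (x y z : N) :
    finslerDist I G x z ≤ finslerDist I G x y + finslerDist I G y z := by
  refine le_of_forall_pos_lt_add fun ε hε => ?_
  obtain ⟨γ, a, b, hγ, hγl⟩ := exists_length_lt (hG.exists_isPath x y)
    (lt_add_of_pos_right (finslerDist I G x y) (half_pos hε))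
  obtain ⟨η, c, d, hη, hηl⟩ := exists_length_lt (hG.exists_isPath y z)
    (lt_add_of_pos_right (finslerDist I G y z) (half_pos hε))
  obtain ⟨ζ, e, hζ, hζl⟩ := hG.exists_path_trans hγ hη
  linarith [hG.finslerDist_le hζ]

/-- By the triangle inequality it suffices that d(y, z) and d(z, y) are both small for z near y.
Without symmetry each one-sided continuity needs both. -/
theorem continuous_finslerDist (hG : IsHomogeneousMetric I G) (x : N) :
    Continuous (finslerDist I G x) ∧ Continuous fun y => finslerDist I G y x := by
  have key : ∀ y, ∀ ε > 0, ∀ᶠ z in 𝓝 y, finslerDist I G y z < ε ∧ finslerDist I G z y < ε := by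
    intro y ε hε
    obtain ⟨U, hU, h⟩ := hG.exists_nhds_path_length_lt y hε
    filter_upwards [hU] with z hz
    obtain ⟨γ, hγ, hγl⟩ := h y (mem_of_mem_nhds hU) z hz
    obtain ⟨η, hη, hηl⟩ := h z hz y (mem_of_mem_nhds hU)
    exact ⟨(hG.finslerDist_le hγ).trans_lt hγl, (hG.finslerDist_le hη).trans_lt hηl⟩
  constructor
  all_goals
    refine continuous_iff_continuousAt.2 fun y => Metric.tendsto_nhds.2 fun ε hε => ?_
    filter_upwards [key y ε hε] with z hz
    rw [Real.dist_eq, abs_sub_lt_iff]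
  · constructor <;> linarith [hG.finslerDist_triangle x y z, hG.finslerDist_triangle x z y]
  · constructor <;> linarith [hG.finslerDist_triangle z y x, hG.finslerDist_triangle y z x]

end IsHomogeneousMetric

end Distance

/-! ### Causal vectors -/

section Euler

variable {V : Type*} [NormedAddCommGroup V] [NormedSpace ℝ V] {g : V → ℝ} {w : V}

/-- Euler's relation: differentiate g(cw) = c² g(w) at c = 1. -/
theorem fderiv_apply_self_of_homogeneous (hg : DifferentiableAt ℝ g w)
    (hom : ∀ u, ∀ c : ℝ, 0 < c → g (c • u) = c ^ 2 * g u) : fderiv ℝ g w w = 2 * g w := by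
  have h1 : HasDerivAt (fun c : ℝ => g (c • w)) (fderiv ℝ g w w) 1 := by
    have h2 : HasDerivAt (fun c : ℝ => c • w) w 1 := by
      simpa using (hasDerivAt_id (1 : ℝ)).smul_const w
    have h3 : HasFDerivAt g (fderiv ℝ g w) ((1 : ℝ) • w) := by simpa using hg.hasFDerivAt
    exact h3.comp_hasDerivAt 1 h2
  have h2 : HasDerivAt (fun c : ℝ => c ^ 2 * g w) (2 * g w) 1 := by
    simpa using (hasDerivAt_pow 2 (1 : ℝ)).mul_const (g w)
  refine h1.unique (h2.congr_of_eventuallyEq ?_)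
  filter_upwards [lt_mem_nhds one_pos] with c hc using hom w c hc

/-- The differential of a 2-homogeneous function is 1-homogeneous. Its derivative in the radial
direction is therefore itself. -/
theorem iteratedFDeriv_two_self_of_homogeneous (hg : ContDiffAt ℝ 2 g w)
    (hom : ∀ u, ∀ c : ℝ, 0 < c → g (c • u) = c ^ 2 * g u) (u : V) :
    iteratedFDeriv ℝ 2 g w ![w, u] = fderiv ℝ g w u := by
  have hd : DifferentiableAt ℝ (fderiv ℝ g) w :=
    (hg.fderiv_right (m := 1) (by norm_num)).differentiableAt (by simp)
  have h1 : HasDerivAt (fun c : ℝ => fderiv ℝ g (c • w) u) (fderiv ℝ (fderiv ℝ g) w w u) 1 := by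
    have h2 : HasDerivAt (fun c : ℝ => c • w) w 1 := by
      simpa using (hasDerivAt_id (1 : ℝ)).smul_const w
    have h3 : HasFDerivAt (fderiv ℝ g) (fderiv ℝ (fderiv ℝ g) w) ((1 : ℝ) • w) := by
      simpa using hd.hasFDerivAt
    exact (ContinuousLinearMap.apply ℝ ℝ u).hasFDerivAt.comp_hasDerivAt 1 (h3.comp_hasDerivAt 1 h2)
  have h2 : HasDerivAt (fun c : ℝ => c * fderiv ℝ g w u) (fderiv ℝ g w u) 1 := by
    simpa using (hasDerivAt_id (1 : ℝ)).mul_const (fderiv ℝ g w u)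
  rw [iteratedFDeriv_two_apply]
  refine h1.unique (h2.congr_of_eventuallyEq ?_)
  filter_upwards [lt_mem_nhds one_pos] with c hc
  have h3 : (fun u => g (c • u)) = fun u => c ^ 2 * g u := funext fun u => hom u c hc
  have h4 : c • fderiv ℝ g (c • w) = c ^ 2 • fderiv ℝ g w := by
    rw [← fderiv_comp_smul, h3, fderiv_const_mul (hg.differentiableAt (by norm_num))]
  have h5 := congrArg (fun A : V →L[ℝ] ℝ => A u) h4
  simp only [smul_apply, smul_eq_mul] at h5
  have : c * (fderiv ℝ g (c • w) u) = c * (c * fderiv ℝ g w u) := by rw [h5]; ring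
  exact mul_left_cancel₀ hc.ne' this

end Euler

/-! ### The causal cone of a static Finsler spacetime -/

section Static

variable {E : Type*} [NormedAddCommGroup E] [NormedSpace ℝ E]
  {H : Type*} [TopologicalSpace H] {I : ModelWithCorners ℝ E H}
  {M : Type*} [TopologicalSpace M] [ChartedSpace H M] [IsManifold I ∞ M]
  {F : TangentBundle I M → ℝ} {Λ : M → ℝ}

/-- In the trivialization at x the inclusion of the fibre over x is a continuous linear map. This
carries smoothness of F on the bundle to single fibres, where the vertical Hessian is computed. -/
theorem contMDiff_tangentBundle_mk (x : M) :
    ContMDiff 𝓘(ℝ, E) I.tangent ∞ fun v : E => (⟨x, v⟩ : TangentBundle I M) := by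
  intro v
  refine (Bundle.contMDiffAt_totalSpace (F := E) (E := (TangentSpace I : M → Type _))
    (f := fun v : E => (⟨x, v⟩ : TangentBundle I M))).2 ⟨contMDiffAt_const, ?_⟩
  let A : E →L[ℝ] E :=
    (trivializationAt E (TangentSpace I : M → Type _) x).continuousLinearMapAt ℝ x
  have h1 : (fun v : E => (trivializationAt E (TangentSpace I : M → Type _) x
      (⟨x, v⟩ : TangentBundle I M)).2) = A := by
    ext v
    change _ = (trivializationAt E (TangentSpace I : M → Type _) x).continuousLinearMapAt ℝ x v
    rw [Bundle.Trivialization.continuousLinearMapAt_apply,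
      Bundle.Trivialization.coe_linearMapAt_of_mem]
    exact FiberBundle.mem_baseSet_trivializationAt' x
  change ContMDiffAt 𝓘(ℝ, E) 𝓘(ℝ, E) ∞ (fun v : E => (trivializationAt E
    (TangentSpace I : M → Type _) x (⟨x, v⟩ : TangentBundle I M)).2) v
  rw [h1]
  exact A.contDiff.contMDiff.contMDiffAt

theorem IsFinslerMetric.contDiffAt (hF : IsFinslerMetric I F) (x : M) {v : E} (hv : v ≠ 0) :
    ContDiffAt ℝ ∞ (fun u : E => F ⟨x, u⟩) v := by
  have h1 : ContMDiffOn 𝓘(ℝ, E) 𝓘(ℝ, ℝ) ∞ (fun u : E => F ⟨x, u⟩) {u | u ≠ 0} :=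
    hF.smooth.comp (contMDiff_tangentBundle_mk x).contMDiffOn fun u hu => hu
  exact (contMDiffOn_iff_contDiffOn.1 h1).contDiffAt (isOpen_ne.mem_nhds hv)

theorem IsFinslerMetric.isHomogeneousMetric_opticalMetric (hF : IsFinslerMetric I F)
    (hΛ : ContMDiff I 𝓘(ℝ, ℝ) ∞ Λ) (hΛ_pos : ∀ x, 0 < Λ x) :
    IsHomogeneousMetric I (opticalMetric I Λ F) where
  continuous := by
    have h : Continuous fun v : TangentBundle I M => √(Λ v.1) :=
      (hΛ.continuous.comp (FiberBundle.continuous_proj E (TangentSpace I))).sqrt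
    exact hF.continuous.div h fun v => (Real.sqrt_pos.2 (hΛ_pos _)).ne'
  smooth := by
    have h1 : ContMDiff I 𝓘(ℝ, ℝ) ∞ fun x => (√(Λ x))⁻¹ := fun x => by
      have h2 : ContDiffAt ℝ ∞ (fun r : ℝ => (√r)⁻¹) (Λ x) :=
        (Real.contDiffAt_sqrt (hΛ_pos x).ne').inv (Real.sqrt_pos.2 (hΛ_pos x)).ne'
      exact h2.contMDiffAt.comp x (hΛ x)
    have h2 : ContMDiff I.tangent 𝓘(ℝ, ℝ) ∞ fun v : TangentBundle I M => (√(Λ v.1))⁻¹ :=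
      h1.comp (Bundle.contMDiff_proj (TangentSpace I))
    exact hF.smooth.mul h2.contMDiffOn
  pos v hv := div_pos (hF.pos v hv) (Real.sqrt_pos.2 (hΛ_pos _))
  homogeneous x v c hc := by
    simp only [opticalMetric, hF.homogeneous x v c hc, mul_div_assoc]

/-- Both formulas are Euler's relations for the 2-homogeneous function L on one fibre. In the
second, only -Λτ² depends on the ∂_t direction. Since v ≠ 0, F² is smooth at the point in question.
-/
theorem IsFinslerMetric.vertHess_staticL (hF : IsFinslerMetric I F)
    (w : TangentBundle (𝓘(ℝ, ℝ).prod I) (ℝ × M)) (hw : (w.2 : ℝ × E).2 ≠ 0) :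
    vertHess (𝓘(ℝ, ℝ).prod I) (staticL I Λ F) w w.2 w.2 =
        -Λ w.1.2 * ((w.2 : ℝ × E).1) ^ 2 + F ⟨w.1.2, (w.2 : ℝ × E).2⟩ ^ 2 ∧
      vertHess (𝓘(ℝ, ℝ).prod I) (staticL I Λ F) w w.2 (dt I M w.1) =
        -Λ w.1.2 * (w.2 : ℝ × E).1 := by
  obtain ⟨⟨t, x⟩, τ, v⟩ := w
  change v ≠ 0 at hw
  set g : ℝ × E → ℝ := fun u => -Λ x * u.1 ^ 2 + F ⟨x, u.2⟩ ^ 2 with hg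
  have hgd : ContDiffAt ℝ 2 g (τ, v) := by
    have h1 : ContDiffAt ℝ 2 (fun u : ℝ × E => F ⟨x, u.2⟩) (τ, v) :=
      ContDiffAt.comp (g := fun u : E => F ⟨x, u⟩) (f := Prod.snd) (τ, v)
        ((hF.contDiffAt x hw).of_le (by norm_cast)) contDiffAt_snd
    exact (contDiffAt_const.mul (contDiffAt_fst.pow 2)).add (h1.pow 2)
  have hom : ∀ u, ∀ c : ℝ, 0 < c → g (c • u) = c ^ 2 * g u := fun u c hc => by
    have h1 : F ⟨x, c • u.2⟩ = c * F ⟨x, u.2⟩ := hF.homogeneous x u.2 c hc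
    simp only [hg, Prod.smul_fst, Prod.smul_snd, smul_eq_mul, h1]
    ring
  have hdt : fderiv ℝ g (τ, v) (1, 0) = -2 * Λ x * τ := by
    have h1 : HasDerivAt (fun r : ℝ => ((r, v) : ℝ × E)) (1, 0) τ :=
      (hasDerivAt_id τ).prodMk (hasDerivAt_const τ v)
    have h2 := (hgd.differentiableAt (by norm_num)).hasFDerivAt.comp_hasDerivAt τ h1
    have h3 : HasDerivAt (fun r : ℝ => g (r, v)) (-2 * Λ x * τ) τ := by
      have := (((hasDerivAt_id τ).pow 2).const_mul (-Λ x)).add_const (F ⟨x, v⟩ ^ 2)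
      exact this.congr_deriv (by simp; ring)
    exact h2.unique h3
  constructor
  · change 1 / 2 * iteratedFDeriv ℝ 2 g (τ, v) ![(τ, v), (τ, v)] = g (τ, v)
    rw [iteratedFDeriv_two_self_of_homogeneous hgd hom,
      fderiv_apply_self_of_homogeneous (hgd.differentiableAt (by norm_num)) hom]
    ring
  · change 1 / 2 * iteratedFDeriv ℝ 2 g (τ, v) ![(τ, v), (1, 0)] = -Λ x * τ
    rw [iteratedFDeriv_two_self_of_homogeneous hgd hom, hdt]
    ring

omit [IsManifold I ∞ M] in
theorem inLine_dt_iff (w : TangentBundle (𝓘(ℝ, ℝ).prod I) (ℝ × M)) :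
    InLine (𝓘(ℝ, ℝ).prod I) (dt I M) w ↔ (w.2 : ℝ × E).2 = 0 := by
  obtain ⟨p, τ, v⟩ := w
  change (∃ c : ℝ, ((τ, v) : ℝ × E) = c • ((1, 0) : ℝ × E)) ↔ v = 0
  constructor
  · rintro ⟨c, hc⟩
    simpa using congrArg Prod.snd hc
  · rintro rfl
    exact ⟨τ, by simp⟩

/-- Off the line of ∂_t, -Λτ < 0 fixes the sign of τ and F² ≤ Λτ² becomes F ≤ √Λ τ. On the line the
condition is τ > 0, which fits the same formula because F vanishes on zero vectors. -/
theorem IsFinslerMetric.isCausalVec_and_isFuturePointingVec_iff (hF : IsFinslerMetric I F)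
    (hΛ_pos : ∀ x, 0 < Λ x) (w : TangentBundle (𝓘(ℝ, ℝ).prod I) (ℝ × M)) :
    (IsCausalVec (𝓘(ℝ, ℝ).prod I) (staticL I Λ F) (dt I M) w ∧
        IsFuturePointingVec (𝓘(ℝ, ℝ).prod I) (staticL I Λ F) (dt I M) w) ↔
      0 < (w.2 : ℝ × E).1 ∧
        opticalMetric I Λ F ⟨w.1.2, (w.2 : ℝ × E).2⟩ ≤ (w.2 : ℝ × E).1 := by
  have hline := inLine_dt_iff (I := I) w
  have hF0 : F ⟨w.1.2, 0⟩ = 0 := by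
    have h := hF.homogeneous w.1.2 0 2 two_pos
    rw [smul_zero] at h
    linarith
  have hfut : (∃ c : ℝ, 0 < c ∧ w.2 = c • dt I M w.1) ↔
      (w.2 : ℝ × E).2 = 0 ∧ 0 < (w.2 : ℝ × E).1 := by
    obtain ⟨p, τ, v⟩ := w
    change (∃ c : ℝ, 0 < c ∧ ((τ, v) : ℝ × E) = c • ((1, 0) : ℝ × E)) ↔ v = 0 ∧ 0 < τ
    constructor
    · rintro ⟨c, hc, h⟩
      have h1 : τ = c := by simpa using congrArg Prod.fst h
      exact ⟨by simpa using congrArg Prod.snd h, h1 ▸ hc⟩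
    · rintro ⟨rfl, h⟩
      exact ⟨τ, h, by simp⟩
  unfold IsCausalVec IsFuturePointingVec IsTimelikeVec IsLightlikeVec
  rw [hline, hfut]
  by_cases hv : (w.2 : ℝ × E).2 = 0
  · simp only [hv, opticalMetric]
    have h0 : 0 < (w.2 : ℝ × E).1 → w.2 ≠ 0 := fun h h' => h.ne' (congrArg Prod.fst h')
    constructor
    · rintro ⟨-, h | h⟩
      · refine ⟨h.2, ?_⟩
        have : F ⟨w.1.2, (0 : E)⟩ = 0 := hF0
        rw [this, zero_div]
        exact h.2.le
      · exact absurd trivial h.1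
    · rintro ⟨h, -⟩
      exact ⟨Or.inl (Or.inl ⟨trivial, h0 h⟩), Or.inl ⟨trivial, h⟩⟩
  · obtain ⟨h1, h2⟩ := hF.vertHess_staticL (Λ := Λ) w hv
    have hΛw := hΛ_pos w.1.2
    have hFw : 0 < F ⟨w.1.2, (w.2 : ℝ × E).2⟩ := hF.pos _ hv
    simp only [hv, h1, h2, false_and, false_or, not_false_eq_true, true_and, opticalMetric]
    rw [div_le_iff₀ (Real.sqrt_pos.2 hΛw), ← le_iff_lt_or_eq]
    constructor
    · rintro ⟨h3, h4⟩
      have h5 : 0 < (w.2 : ℝ × E).1 := by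
        by_contra h5
        nlinarith
      refine ⟨h5, abs_le_of_sq_le_sq' ?_ (by positivity) |>.2⟩
      rw [mul_pow, Real.sq_sqrt hΛw.le]
      linarith
    · rintro ⟨h3, h4⟩
      refine ⟨?_, by nlinarith⟩
      have := pow_le_pow_left₀ hFw.le h4 2
      rw [mul_pow, Real.sq_sqrt hΛw.le] at this
      linarith

end Static

/-- At a breakpoint the half-open interval selects the piece to its right, which determines the
right derivative. The `Ioc` version does the same for left derivatives. -/
theorem Subdivisible.exists_mem_Ico {Q : ℝ → ℝ → Prop} {a b s : ℝ} (h : Subdivisible Q a b)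
    (hs : s ∈ Ico a b) : ∃ c d, Q c d ∧ a ≤ c ∧ d ≤ b ∧ s ∈ Ico c d := by
  revert hs
  refine Relation.ReflTransGen.head_induction_on h (fun hs => absurd hs (by simp)) ?_
  rintro a c hac hcb ih hs
  by_cases hsc : s < c
  · exact ⟨a, c, hac.2, le_rfl, Subdivisible.le hcb, hs.1, hsc⟩
  · obtain ⟨p, q, hpq, hp, hq, hs'⟩ := ih ⟨not_lt.1 hsc, hs.2⟩
    exact ⟨p, q, hpq, hac.1.le.trans hp, hq, hs'⟩

theorem Subdivisible.exists_mem_Ioc {Q : ℝ → ℝ → Prop} {a b s : ℝ} (h : Subdivisible Q a b)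
    (hs : s ∈ Ioc a b) : ∃ c d, Q c d ∧ a ≤ c ∧ d ≤ b ∧ s ∈ Ioc c d := by
  revert hs
  refine Relation.ReflTransGen.head_induction_on h (fun hs => absurd hs (by simp)) ?_
  rintro a c hac hcb ih hs
  by_cases hsc : s ≤ c
  · exact ⟨a, c, hac.2, le_rfl, Subdivisible.le hcb, hs.1, hsc⟩
  · obtain ⟨p, q, hpq, hp, hq, hs'⟩ := ih ⟨not_le.1 hsc, hs.2⟩
    exact ⟨p, q, hpq, hac.1.le.trans hp, hq, hs'⟩

section Static

variable {E : Type*} [NormedAddCommGroup E] [NormedSpace ℝ E]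
  {H : Type*} [TopologicalSpace H] {I : ModelWithCorners ℝ E H}
  {M : Type*} [TopologicalSpace M] [ChartedSpace H M]
  {F : TangentBundle I M → ℝ} {Λ : M → ℝ} {a b c d : ℝ}

/-! ### Causal curves -/

theorem velocityWithin_prod {γ : ℝ → ℝ × M} {S : Set ℝ} {s : ℝ}
    (h : MDifferentiableWithinAt 𝓘(ℝ, ℝ) (𝓘(ℝ, ℝ).prod I) γ S s)
    (hS : UniqueDiffWithinAt ℝ S s) :
    ((velocityWithin (𝓘(ℝ, ℝ).prod I) γ S s).2 : ℝ × E) =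
      (derivWithin (fun r => (γ r).1) S s, (velocityWithin I (fun r => (γ r).2) S s).2) := by
  have h1 := ((hasMFDerivAt_fst (I := 𝓘(ℝ, ℝ)) (I' := I) (γ s)).comp_hasMFDerivWithinAt s
    h.hasMFDerivWithinAt).mfderivWithin hS.uniqueMDiffWithinAt
  have h2 := ((hasMFDerivAt_snd (I := 𝓘(ℝ, ℝ)) (I' := I) (γ s)).comp_hasMFDerivWithinAt s
    h.hasMFDerivWithinAt).mfderivWithin hS.uniqueMDiffWithinAt
  refine Prod.ext ?_ ?_
  · rw [mfderivWithin_eq_fderivWithin] at h1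
    have := congrArg (fun A : ℝ →L[ℝ] ℝ => A 1) h1
    exact this.symm
  · exact (congrArg (fun A : ℝ →L[ℝ] E => A 1) h2).symm

/-- The curve `(t, σ)` is smooth on `[c, d]`, and its velocity is future-pointing and causal
with respect to the homogeneous metric `G`. -/
def IsCausalPiece (G : TangentBundle I M → ℝ) (t : ℝ → ℝ) (σ : ℝ → M) (c d : ℝ) : Prop :=
  ContDiffOn ℝ ∞ t (Icc c d) ∧ ContMDiffOn 𝓘(ℝ, ℝ) I ∞ σ (Icc c d) ∧
    ∀ s ∈ Icc c d, 0 < derivWithin t (Icc c d) s ∧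
      G (velocityWithin I σ (Icc c d) s) ≤ derivWithin t (Icc c d) s

theorem IsCausalPiece.congr {G : TangentBundle I M → ℝ} {t t' : ℝ → ℝ} {σ σ' : ℝ → M}
    (h : IsCausalPiece G t σ c d) (ht : EqOn t' t (Icc c d)) (hσ : EqOn σ' σ (Icc c d)) :
    IsCausalPiece G t' σ' c d := by
  refine ⟨h.1.congr ht, h.2.1.congr hσ, fun s hs => ?_⟩
  rw [derivWithin_congr ht (ht hs), velocityWithin_congr hσ hs]
  exact h.2.2 s hs

theorem IsCausalPiece.comp_add_right {G : TangentBundle I M → ℝ} {t : ℝ → ℝ} {σ : ℝ → M}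
    (hcd : c < d) (h : IsCausalPiece G t σ c d) (δ : ℝ) :
    IsCausalPiece G (t ∘ (· + δ)) (σ ∘ (· + δ)) (c - δ) (d - δ) := by
  have hmaps : MapsTo (· + δ) (Icc (c - δ) (d - δ)) (Icc c d) := fun s hs =>
    ⟨by linarith [hs.1], by linarith [hs.2]⟩
  have hsm : ContDiff ℝ ∞ (· + δ) := by fun_prop
  refine ⟨h.1.comp hsm.contDiffOn hmaps, h.2.1.comp hsm.contMDiff.contMDiffOn hmaps,
    fun s hs => ?_⟩
  have hU : UniqueDiffWithinAt ℝ (Icc (c - δ) (d - δ)) s :=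
    uniqueDiffOn_Icc (by linarith) s hs
  have hd : HasDerivWithinAt (· + δ) 1 (Icc (c - δ) (d - δ)) s :=
    (hasDerivWithinAt_id s _).add_const δ
  have h1 := velocityWithin_comp (u := (· + δ)) ((h.2.1.mdifferentiableOn (by simp)) _ (hmaps hs)) hd hmaps hU
  have h2 : derivWithin (t ∘ (· + δ)) (Icc (c - δ) (d - δ)) s =
      derivWithin t (Icc c d) (s + δ) := by
    have := ((h.1.differentiableOn (by simp) _ (hmaps hs)).hasDerivWithinAt.comp s hd hmaps)
    simpa using this.derivWithin hU
  rw [h1, h2, one_smul]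
  exact h.2.2 _ (hmaps hs)

theorem contMDiffOn_prod_iff {γ : ℝ → ℝ × M} {S : Set ℝ} :
    ContMDiffOn 𝓘(ℝ, ℝ) (𝓘(ℝ, ℝ).prod I) ∞ γ S ↔
      ContDiffOn ℝ ∞ (fun r => (γ r).1) S ∧ ContMDiffOn 𝓘(ℝ, ℝ) I ∞ (fun r => (γ r).2) S := by
  rw [← contMDiffOn_iff_contDiffOn]
  exact ⟨fun h => ⟨contMDiff_fst.comp_contMDiffOn h, contMDiff_snd.comp_contMDiffOn h⟩,
    fun h => h.1.prodMk h.2⟩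

variable [IsManifold I ∞ M]

/-- On each closed smooth piece every derivative within the piece is a left or right velocity of the
curve, and every one-sided velocity arises in this way. So the two families of pointwise conditions
become one condition per piece, endpoints included. -/
theorem IsFinslerMetric.isFutureCausalCurve_iff (hF : IsFinslerMetric I F)
    (hΛ_pos : ∀ x, 0 < Λ x) (γ : ℝ → ℝ × M) :
    IsFutureCausalCurve (𝓘(ℝ, ℝ).prod I) (staticL I Λ F) (dt I M) γ a b ↔
      a < b ∧ Subdivisible (IsCausalPiece (opticalMetric I Λ F) (fun r => (γ r).1)
        fun r => (γ r).2) a b := by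
  have key : ∀ {c d s : ℝ}, ContMDiffOn 𝓘(ℝ, ℝ) (𝓘(ℝ, ℝ).prod I) ∞ γ (Icc c d) → c < d →
      s ∈ Icc c d →
      ((IsCausalVec (𝓘(ℝ, ℝ).prod I) (staticL I Λ F) (dt I M)
          (velocityWithin (𝓘(ℝ, ℝ).prod I) γ (Icc c d) s) ∧
        IsFuturePointingVec (𝓘(ℝ, ℝ).prod I) (staticL I Λ F) (dt I M)
          (velocityWithin (𝓘(ℝ, ℝ).prod I) γ (Icc c d) s)) ↔
      (0 < derivWithin (fun r => (γ r).1) (Icc c d) s ∧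
        opticalMetric I Λ F (velocityWithin I (fun r => (γ r).2) (Icc c d) s) ≤
          derivWithin (fun r => (γ r).1) (Icc c d) s)) := by
    intro c d s hγ hcd hs
    rw [hF.isCausalVec_and_isFuturePointingVec_iff hΛ_pos,
      velocityWithin_prod ((hγ.mdifferentiableOn (by simp)) s hs) (uniqueDiffOn_Icc hcd s hs)]
    exact Iff.rfl
  constructor
  · rintro ⟨hγ, hr, hl⟩
    refine ⟨hγ.1, hγ.subdivisible.bounded.mono fun c d hcd hQ => ?_⟩
    have hsm := contMDiffOn_prod_iff.1 hQ.1
    refine ⟨hsm.1, hsm.2, fun s hs => (key hQ.1 hcd hs).1 ?_⟩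
    have hdiff := (hQ.1.mdifferentiableOn (by simp)) s hs
    rcases hs.2.eq_or_lt with rfl | hsd
    · rw [← leftVelocity_eq ⟨hcd, le_rfl⟩ hdiff]
      exact hl s ⟨hQ.2.1.le.trans_lt hcd, hQ.2.2.le⟩
    · rw [← rightVelocity_eq ⟨hs.1, hsd⟩ hdiff]
      exact hr s ⟨hQ.2.1.le.trans hs.1, hsd.trans_le hQ.2.2.le⟩
  · rintro ⟨hab, hγ⟩
    have hpw : IsPiecewiseSmooth (𝓘(ℝ, ℝ).prod I) γ a b :=
      .of_subdivisible hab (hγ.mono fun c d _ h => contMDiffOn_prod_iff.2 ⟨h.1, h.2.1⟩)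
    refine ⟨hpw, fun s hs => ?_, fun s hs => ?_⟩
    · obtain ⟨c, d, hQ, -, -, hs'⟩ := hγ.exists_mem_Ico hs
      have hsm := contMDiffOn_prod_iff.2 ⟨hQ.1, hQ.2.1⟩
      have hcd := hs'.1.trans_lt hs'.2
      have hs'' := Ico_subset_Icc_self hs'
      rw [rightVelocity_eq hs' ((hsm.mdifferentiableOn (by simp)) s hs'')]
      exact (key hsm hcd hs'').2 (hQ.2.2 s hs'')
    · obtain ⟨c, d, hQ, -, -, hs'⟩ := hγ.exists_mem_Ioc hs
      have hsm := contMDiffOn_prod_iff.2 ⟨hQ.1, hQ.2.1⟩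
      have hcd := hs'.1.trans_le hs'.2
      have hs'' := Ioc_subset_Icc_self hs'
      rw [leftVelocity_eq hs' ((hsm.mdifferentiableOn (by simp)) s hs'')]
      exact (key hsm hcd hs'').2 (hQ.2.2 s hs'')

/-- There is a future-pointing causal curve `(t, σ)` from `p` to `q`, with respect to the
homogeneous metric `G`, or `p = q`. -/
def Precedes (G : TangentBundle I M → ℝ) (p q : ℝ × M) : Prop :=
  p = q ∨ ∃ (t : ℝ → ℝ) (σ : ℝ → M) (a b : ℝ), a < b ∧ Subdivisible (IsCausalPiece G t σ) a b ∧
    (t a, σ a) = p ∧ (t b, σ b) = q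

theorem IsFinslerMetric.causallyRelated_iff (hF : IsFinslerMetric I F)
    (hΛ_pos : ∀ x, 0 < Λ x) (p q : ℝ × M) :
    CausallyRelated (𝓘(ℝ, ℝ).prod I) (staticL I Λ F) (dt I M) p q ↔
      Precedes (opticalMetric I Λ F) p q := by
  refine or_congr Iff.rfl ⟨?_, ?_⟩
  · rintro ⟨γ, a, b, hγ, rfl, rfl⟩
    have := (hF.isFutureCausalCurve_iff hΛ_pos γ).1 hγ
    exact ⟨_, _, a, b, this.1, this.2, rfl, rfl⟩
  · rintro ⟨t, σ, a, b, hab, h, rfl, rfl⟩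
    exact ⟨fun r => (t r, σ r), a, b, (hF.isFutureCausalCurve_iff hΛ_pos _).2 ⟨hab, h⟩, rfl, rfl⟩

variable {G : TangentBundle I M → ℝ} {t : ℝ → ℝ} {σ : ℝ → M}

omit [IsManifold I ∞ M] in
theorem Precedes.trans {p q r : ℝ × M} (h₁ : Precedes G p q) (h₂ : Precedes G q r) :
    Precedes G p r := by
  classical
  rcases h₁ with rfl | ⟨t, σ, a, b, hab, h₁, rfl, hq⟩
  · exact h₂
  rcases h₂ with rfl | ⟨t', σ', c, d, hcd, h₂, hq', rfl⟩
  · exact Or.inr ⟨t, σ, a, b, hab, h₁, rfl, hq⟩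
  have hbc : b + (c - b) = c := by ring
  have hqq : t b = t' c ∧ σ b = σ' c := by
    rw [← hq] at hq'
    exact ⟨(congrArg Prod.fst hq').symm, (congrArg Prod.snd hq').symm⟩
  refine Or.inr ⟨fun s => if s ≤ b then t s else t' (s + (c - b)),
    fun s => if s ≤ b then σ s else σ' (s + (c - b)), a, d - (c - b), by linarith, ?_, ?_, ?_⟩
  · refine Subdivisible.trans (b := b) (h₁.bounded.mono fun p q hpq hQ =>
      hQ.1.congr (fun s hs => if_pos (hs.2.trans hQ.2.2.le))
        (fun s hs => if_pos (hs.2.trans hQ.2.2.le))) ?_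
    -- The second curve is shifted to start at b. Carrying `b ≤ p` leaves only s = b as a point
    -- where the glued functions use the first curve, and there the two curves agree.
    have h₃ := h₂.bounded.map
      (R := fun p q => IsCausalPiece G (t' ∘ (· + (c - b))) (σ' ∘ (· + (c - b))) p q ∧ b ≤ p)
      (· - (c - b)) fun p q hpq hQ =>
        ⟨by simpa using hpq, hQ.1.comp_add_right hpq _, by linarith [hQ.2.1.le]⟩
    rw [show c - (c - b) = b by ring] at h₃
    refine h₃.mono fun p q hpq hQ => hQ.1.congr (fun s hs => ?_) (fun s hs => ?_)
    all_goals
      rcases (hQ.2.trans hs.1).eq_or_lt with rfl | hbs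
    · simp only [le_refl, if_true, hqq.1, Function.comp_apply, hbc]
    · simp only [not_le.2 hbs, if_false, Function.comp_apply]
    · simp only [le_refl, if_true, hqq.2, Function.comp_apply, hbc]
    · simp only [not_le.2 hbs, if_false, Function.comp_apply]
  · simp only [hab.le, if_true]
  · have : ¬ d - (c - b) ≤ b := by linarith
    simp only [this, if_false, sub_add_cancel]

/-- Waiting at a point costs no length, so surplus time can be spent at the end of a curve. -/
theorem IsHomogeneousMetric.precedes_vertical (hG : IsHomogeneousMetric I G) {t₀ t₁ : ℝ} (h : t₀ ≤ t₁)
    (x : M) : Precedes G (t₀, x) (t₁, x) := by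
  rcases h.eq_or_lt with rfl | h
  · exact Or.inl rfl
  refine Or.inr ⟨id, fun _ => x, t₀, t₁, h, .single h ⟨contDiffOn_id, contMDiffOn_const,
    fun s hs => ?_⟩, rfl, rfl⟩
  have h1 : velocityWithin I (fun _ : ℝ => x) (Icc t₀ t₁) s = ⟨x, 0⟩ := by
    rw [velocityWithin_subset (subset_univ _) (uniqueDiffOn_Icc h s hs)
      mdifferentiableWithinAt_const, velocityWithin_univ, velocity_const]
  rw [derivWithin_id _ _ (uniqueDiffOn_Icc h s hs), h1, hG.map_zero]
  exact ⟨one_pos, zero_le_one⟩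

/-- Along a causal curve the length of the spatial part is at most the elapsed time. -/
theorem IsHomogeneousMetric.length_le_of_causal (hG : IsHomogeneousMetric I G) (hab : a < b)
    (h : Subdivisible (IsCausalPiece G t σ) a b) :
    IsPiecewiseSmooth I σ a b ∧ t a < t b ∧ length I G σ a b ≤ t b - t a := by
  have key : ∀ b, Subdivisible (IsCausalPiece G t σ) a b → a = b ∨ (IsPiecewiseSmooth I σ a b ∧
      t a < t b ∧ length I G σ a b ≤ t b - t a) := fun b hb => by
    clear hab
    induction hb with
    | refl => exact Or.inl rfl
    | @tail c d _ hcd ih =>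
      obtain ⟨hcd, ht, hσ, hle⟩ := hcd
      have hpw := IsPiecewiseSmooth.of_contMDiffOn hcd hσ
      have hti : ContinuousOn (derivWithin t (Icc c d)) (Icc c d) :=
        ht.continuousOn_derivWithin (uniqueDiffOn_Icc hcd) (by simp)
      have hint : ∫ s in c..d, derivWithin t (Icc c d) s = t d - t c :=
        intervalIntegral.integral_eq_sub_of_hasDerivAt_of_le hcd.le ht.continuousOn
          (fun s hs => (ht.differentiableOn (by simp) s
            (Ioo_subset_Icc_self hs)).hasDerivWithinAt.hasDerivAt (Icc_mem_nhds hs.1 hs.2))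
          (by rw [← uIcc_of_le hcd.le] at hti ⊢; exact hti.intervalIntegrable)
      have hσi : ContinuousOn (fun s => G (velocityWithin I σ (Icc c d) s)) (Icc c d) :=
        hG.continuous.comp_continuousOn (continuousOn_velocityWithin hcd hσ)
      have h1 : length I G σ c d ≤ t d - t c := by
        rw [← hint, length, integral_velocity_eq hcd.le]
        refine intervalIntegral.integral_mono_on hcd.le ?_ ?_ fun s hs => (hle s hs).2
        · rw [← uIcc_of_le hcd.le] at hσi ⊢; exact hσi.intervalIntegrable
        · rw [← uIcc_of_le hcd.le] at hti ⊢; exact hti.intervalIntegrable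
      have h2 : t c < t d := by
        rw [← sub_pos, ← hint]
        refine intervalIntegral.intervalIntegral_pos_of_pos_on ?_
          (fun s hs => (hle s (Ioo_subset_Icc_self hs)).1) hcd
        rw [← uIcc_of_le hcd.le] at hti ⊢; exact hti.intervalIntegrable
      right
      rcases ih with rfl | ⟨h3, h4, h5⟩
      · exact ⟨hpw, h2, h1⟩
      · refine ⟨h3.trans hpw, h4.trans h2, ?_⟩
        rw [← hG.length_add h3 hpw]
        linarith
  exact (key b h).resolve_left hab.ne

/-- A curve can be lifted to a causal curve taking any time longer than its length. -/
theorem IsHomogeneousMetric.exists_causal_lift (hG : IsHomogeneousMetric I G)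
    (h : IsPiecewiseSmooth I σ a b) :
    ∀ T, length I G σ a b < T → ∀ t₀, Precedes G (t₀, σ a) (t₀ + T, σ b) := by
  refine h.induction (P := fun a b => ∀ T, length I G σ a b < T →
    ∀ t₀, Precedes G (t₀, σ a) (t₀ + T, σ b)) (fun c d _ hcd _ hσ T hT t₀ => ?_)
    fun c d h₁ h₂ h₃ h₄ T hT t₀ => ?_
  · set g : ℝ → ℝ := fun s => G (velocityWithin I σ (Icc c d) s) with hg
    have hσi : ContinuousOn g (Icc c d) :=
      hG.continuous.comp_continuousOn (continuousOn_velocityWithin hcd hσ)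
    have hlen : length I G σ c d = ∫ s in c..d, g s := integral_velocity_eq hcd.le
    have hcd' : 0 < d - c := sub_pos.2 hcd
    obtain ⟨ε, hε, hεT⟩ : ∃ ε > 0, length I G σ c d + 2 * ε * (d - c) = T :=
      ⟨(T - length I G σ c d) / (2 * (d - c)), by apply div_pos <;> linarith, by
        field_simp; ring⟩
    -- The speed g need not be smooth where the velocity vanishes, so its primitive may fail as a
    -- time function. A polynomial within ε of g + ε lies strictly between g and g + 2ε. Its
    -- primitive is smooth, grows faster than the length, and uses at most time T. The remainder is
    -- spent waiting.
    obtain ⟨p, hp⟩ := exists_polynomial_near_of_continuousOn c d (fun s => g s + ε)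
      (hσi.add continuousOn_const) ε hε
    have hp' : ∀ s ∈ Icc c d, g s < p.eval s ∧ p.eval s < g s + 2 * ε := fun s hs => by
      have := abs_lt.1 (hp s hs)
      constructor <;> linarith
    set t : ℝ → ℝ := fun s => t₀ + ∫ r in c..s, p.eval r with ht
    have htd : ∀ s, HasDerivAt t (p.eval s) s := fun s =>
      (intervalIntegral.integral_hasDerivAt_right (p.continuous.intervalIntegrable _ _)
        p.continuous.aestronglyMeasurable.stronglyMeasurableAtFilter
        p.continuous.continuousAt).const_add t₀
    have hts : ContDiff ℝ ∞ t := by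
      rw [contDiff_infty_iff_deriv]
      refine ⟨fun s => (htd s).differentiableAt, ?_⟩
      rw [funext fun s => (htd s).deriv]
      simpa using p.contDiff_aeval (𝕜 := ℝ) ∞
    have h1 : Precedes G (t c, σ c) (t d, σ d) := by
      refine Or.inr ⟨t, σ, c, d, hcd, .single hcd ⟨hts.contDiffOn, hσ, fun s hs => ?_⟩, rfl, rfl⟩
      rw [(htd s).hasDerivWithinAt.derivWithin (uniqueDiffOn_Icc hcd s hs)]
      exact ⟨(hG.nonneg _).trans_lt (hp' s hs).1, (hp' s hs).1.le⟩
    have h2 : t d ≤ t₀ + T := by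
      have hgi : IntervalIntegrable g volume c d := by
        rw [← uIcc_of_le hcd.le] at hσi; exact hσi.intervalIntegrable
      have : ∫ r in c..d, p.eval r ≤ ∫ r in c..d, (g r + 2 * ε) :=
        intervalIntegral.integral_mono_on hcd.le (p.continuous.intervalIntegrable _ _)
          (hgi.add intervalIntegrable_const) fun s hs => (hp' s hs).2.le
      rw [intervalIntegral.integral_add hgi intervalIntegrable_const,
        intervalIntegral.integral_const, smul_eq_mul, ← hlen] at this
      simp only [ht]
      linarith
    have h3 : t c = t₀ := by simp [ht]
    rw [h3] at h1
    exact h1.trans (hG.precedes_vertical h2 _)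
  · rw [← hG.length_add h₁ h₂] at hT
    -- The surplus of T over the total length is split in half between the two parts.
    have h5 := h₃ (T - length I G σ c d - (T - length I G σ a c - length I G σ c d) / 2)
      (by linarith) t₀
    have h6 := h₄ (length I G σ c d + (T - length I G σ a c - length I G σ c d) / 2)
      (by linarith) (t₀ + (T - length I G σ c d - (T - length I G σ a c - length I G σ c d) / 2))
    convert h5.trans h6 using 2
    ring

end Static

section Geodesics

variable {E : Type*} [NormedAddCommGroup E] [NormedSpace ℝ E]
  {H : Type*} [TopologicalSpace H] {I : ModelWithCorners ℝ E H}
  {N : Type*} [TopologicalSpace N] [ChartedSpace H N] [IsManifold I ∞ N]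
  {G : TangentBundle I N → ℝ} {γ σ : ℝ → N} {a b c d : ℝ}

/-! ### Variations, and conservation of energy along geodesics -/

/-- In a chart around γ(s) the mean value inequality makes γ locally constant, and the interval is
connected. Used for the pieces of a geodesic with speed zero. -/
theorem eq_of_velocityWithin_eq_zero (hcd : c < d) (hγ : ContMDiffOn 𝓘(ℝ, ℝ) I ∞ γ (Icc c d))
    (h : ∀ s ∈ Icc c d, (velocityWithin I γ (Icc c d) s).2 = 0) : γ c = γ d := by
  refine isPreconnected_Icc.induction₂ (fun x y => γ x = γ y) (fun s hs => ?_)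
    (fun x y z _ _ _ h₁ h₂ => h₁.trans h₂) (fun x y _ _ h => h.symm) ⟨le_rfl, hcd.le⟩ ⟨hcd.le, le_rfl⟩
  have h1 := (hγ.continuousOn s hs).preimage_mem_nhdsWithin (extChartAt_source_mem_nhds (I := I) (γ s))
  obtain ⟨δ, hδ, hball⟩ := Metric.mem_nhdsWithin_iff.1 h1
  filter_upwards [inter_mem_nhdsWithin (Icc c d) (Metric.ball_mem_nhds s hδ)] with y hy
  set C := Icc c d ∩ Metric.ball s δ with hC
  have hsC : s ∈ C := ⟨hs, Metric.mem_ball_self hδ⟩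
  have hsrc : ∀ x ∈ C, γ x ∈ (extChartAt I (γ s)).source := fun x hx => hball ⟨hx.2, hx.1⟩
  have hderiv : ∀ x ∈ C, HasFDerivWithinAt (extChartAt I (γ s) ∘ γ) (0 : ℝ →L[ℝ] E) C x :=
    fun x hx => by
      have h2 := ((hγ.mdifferentiableOn (by simp)) x hx.1).hasMFDerivWithinAt
      have h3 : mfderivWithin 𝓘(ℝ, ℝ) I γ (Icc c d) x = 0 :=
        ContinuousLinearMap.ext_ring (h x hx.1)
      rw [h3] at h2
      have h4 := (((mdifferentiableAt_extChartAt (I := I) (by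
        simpa [extChartAt_source] using hsrc x hx)).hasMFDerivAt).comp_hasMFDerivWithinAt x h2).mono
          (inter_subset_left : C ⊆ Icc c d)
      rw [ContinuousLinearMap.comp_zero] at h4
      exact hasMFDerivWithinAt_iff_hasFDerivWithinAt.1 h4
  have h5 := ((convex_Icc c d).inter (convex_ball s δ)).norm_image_sub_le_of_norm_hasFDerivWithin_le
    (C := 0) hderiv (by simp) hsC hy
  rw [zero_mul, norm_le_zero_iff, sub_eq_zero] at h5
  exact (extChartAt I (γ s)).injOn (hsrc s hsC) (hsrc y hy) h5.symm

omit [IsManifold I ∞ N] in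
theorem isProperVariation_iff {ψ : ℝ × ℝ → N} {ε : ℝ} :
    IsProperVariation I ψ ε γ a b ↔ 0 < ε ∧ ContinuousOn ψ (Ioo (-ε) ε ×ˢ Icc a b) ∧
      (∀ s ∈ Icc a b, ψ (0, s) = γ s) ∧
      (∀ r ∈ Ioo (-ε) ε, ψ (r, a) = γ a ∧ ψ (r, b) = γ b) ∧
      Subdivisible (fun c d => ContMDiffOn 𝓘(ℝ, ℝ × ℝ) I ∞ ψ (Ioo (-ε) ε ×ˢ Icc c d)) a b := by
  rw [← exists_subdivision_iff]
  exact Iff.rfl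

omit [IsManifold I ∞ N] in
theorem contMDiffOn_slice {ψ : ℝ × ℝ → N} {S T : Set ℝ} {r : ℝ} (hr : r ∈ S)
    (h : ContMDiffOn 𝓘(ℝ, ℝ × ℝ) I ∞ ψ (S ×ˢ T)) :
    ContMDiffOn 𝓘(ℝ, ℝ) I ∞ (fun s => ψ (r, s)) T := by
  refine h.comp (f := fun s : ℝ => (r, s)) ?_ fun s hs => ⟨hr, hs⟩
  rw [contMDiffOn_iff_contDiffOn]
  fun_prop

omit [IsManifold I ∞ N] in
theorem IsProperVariation.isPath {ψ : ℝ × ℝ → N} {ε r : ℝ} (hab : a < b)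
    (h : IsProperVariation I ψ ε γ a b) (hr : r ∈ Ioo (-ε) ε) :
    IsPath I (fun s => ψ (r, s)) a b (γ a) (γ b) := by
  obtain ⟨-, -, -, hends, hsub⟩ := isProperVariation_iff.1 h
  exact ⟨.of_subdivisible hab (hsub.mono fun c d _ hQ => contMDiffOn_slice hr hQ), hends r hr⟩

/-- The squared speed gains a factor α² and the change of variables returns 1/α. -/
theorem IsHomogeneousMetric.integral_sq_velocity_affine (hG : IsHomogeneousMetric I G)
    {α β p q : ℝ} (hα : 0 < α) (hcd : c ≤ d) (hγ : ContMDiffOn 𝓘(ℝ, ℝ) I ∞ γ (Icc p q))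
    (hp : p ≤ α * c + β) (hq : α * d + β ≤ q) :
    ∫ s in c..d, G (velocity I (fun s => γ (α * s + β)) s) ^ 2 =
      α * ∫ s in (α * c + β)..(α * d + β), G (velocity I γ s) ^ 2 := by
  have h1 : ∫ s in c..d, G (velocity I (fun s => γ (α * s + β)) s) ^ 2 =
      ∫ s in c..d, α ^ 2 * G (velocity I γ (α * s + β)) ^ 2 := by
    rw [intervalIntegral.integral_of_le hcd, intervalIntegral.integral_of_le hcd,
      integral_Ioc_eq_integral_Ioo, integral_Ioc_eq_integral_Ioo]
    refine setIntegral_congr_fun measurableSet_Ioo fun s hs => ?_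
    have hs1 : p < α * s + β := by nlinarith [mul_lt_mul_of_pos_left hs.1 hα]
    have hs2 : α * s + β < q := by nlinarith [mul_lt_mul_of_pos_left hs.2 hα]
    have hd : MDifferentiableAt 𝓘(ℝ, ℝ) I γ (α * s + β) :=
      ((hγ.mdifferentiableOn (by simp)) _ ⟨hs1.le, hs2.le⟩).mdifferentiableAt
        (Icc_mem_nhds hs1 hs2)
    have hu : HasDerivAt (fun s => α * s + β) α s := by
      simpa using ((hasDerivAt_id s).const_mul α).add_const β
    have := velocityWithin_comp (u := fun s => α * s + β) (mdifferentiableWithinAt_univ.2 hd)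
      hu.hasDerivWithinAt
      (mapsTo_univ _ _) uniqueDiffWithinAt_univ
    rw [velocityWithin_univ, velocityWithin_univ] at this
    change G (velocity I (γ ∘ fun s => α * s + β) s) ^ 2 = _
    rw [this]
    have h2 := hG.smul hα.le (γ (α * s + β)) (velocity I γ (α * s + β)).2
    exact (congrArg (fun x : ℝ => x ^ 2) h2).trans (mul_pow _ _ _)
  rw [h1, intervalIntegral.integral_const_mul,
    intervalIntegral.integral_comp_mul_add (fun s => G (velocity I γ s) ^ 2) hα.ne' β, smul_eq_mul]
  field_simp

/-! ### Inner variations: sliding a parameter along the curve -/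

/-- The time shift which moves the interior point `m` of `[c, d]` to `m + r`. -/
def tentShift (c m d : ℝ) (z : ℝ × ℝ) : ℝ :=
  z.2 + z.1 * max 0 (min ((z.2 - c) / (m - c)) ((d - z.2) / (d - m)))

theorem continuous_tentShift (c m d : ℝ) : Continuous (tentShift c m d) := by
  unfold tentShift
  fun_prop

section Tent

variable {m r s : ℝ} (hcm : c < m) (hmd : m < d)
include hcm hmd

/-- Left of the peak the shift is the affine map of [c, m] onto [c, m + r], written as αs + β to
match `integral_sq_velocity_affine`. -/
theorem tentShift_left (hs : s ∈ Icc c m) :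
    tentShift c m d (r, s) = (m + r - c) / (m - c) * s + (c - (m + r - c) / (m - c) * c) := by
  have h1 : 0 < m - c := sub_pos.2 hcm
  have h2 : 0 < d - m := sub_pos.2 hmd
  have h3 : (s - c) / (m - c) ≤ 1 := (div_le_one h1).2 (by linarith [hs.2])
  have h4 : 1 ≤ (d - s) / (d - m) := (one_le_div h2).2 (by linarith [hs.2])
  have h5 : 0 ≤ (s - c) / (m - c) := div_nonneg (by linarith [hs.1]) h1.le
  simp only [tentShift]
  rw [min_eq_left (h3.trans h4), max_eq_right h5]
  field_simp
  ring

theorem tentShift_right (hs : s ∈ Icc m d) :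
    tentShift c m d (r, s) = (d - m - r) / (d - m) * s + (d - (d - m - r) / (d - m) * d) := by
  have h1 : 0 < m - c := sub_pos.2 hcm
  have h2 : 0 < d - m := sub_pos.2 hmd
  have h3 : (d - s) / (d - m) ≤ 1 := (div_le_one h2).2 (by linarith [hs.1])
  have h4 : 1 ≤ (s - c) / (m - c) := (one_le_div h1).2 (by linarith [hs.1])
  have h5 : 0 ≤ (d - s) / (d - m) := div_nonneg (by linarith [hs.2]) h2.le
  simp only [tentShift]
  rw [min_eq_right (h3.trans h4), max_eq_right h5]
  field_simp
  ring

theorem tentShift_of_notMem (hs : s ≤ c ∨ d ≤ s) : tentShift c m d (r, s) = s := by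
  have h1 : 0 < m - c := sub_pos.2 hcm
  have h2 : 0 < d - m := sub_pos.2 hmd
  have h3 : min ((s - c) / (m - c)) ((d - s) / (d - m)) ≤ 0 := by
    rcases hs with hs | hs
    · exact min_le_of_left_le (div_nonpos_of_nonpos_of_nonneg (by linarith) h1.le)
    · exact min_le_of_right_le (div_nonpos_of_nonpos_of_nonneg (by linarith) h2.le)
  simp only [tentShift]
  rw [max_eq_left h3, mul_zero, add_zero]

theorem tentShift_mem (hr : r ∈ Ioo (-min (m - c) (d - m)) (min (m - c) (d - m)))
    (hs : s ∈ Icc c d) : tentShift c m d (r, s) ∈ Icc c d := by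
  have h1 : 0 < m - c := sub_pos.2 hcm
  have h2 : 0 < d - m := sub_pos.2 hmd
  have h3 := hr.1
  have h4 := hr.2
  have h5 := min_le_left (m - c) (d - m)
  have h6 := min_le_right (m - c) (d - m)
  rcases le_total s m with hsm | hsm
  · rw [tentShift_left hcm hmd ⟨hs.1, hsm⟩]
    set α := (m + r - c) / (m - c) with hα
    have h7 : 0 < α := div_pos (by linarith) h1
    have h8 : α * (m - c) = m + r - c := by rw [hα]; field_simp
    constructor <;> nlinarith [hs.1]
  · rw [tentShift_right hcm hmd ⟨hsm, hs.2⟩]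
    set α := (d - m - r) / (d - m) with hα
    have h7 : 0 < α := div_pos (by linarith) h2
    have h8 : α * (d - m) = d - m - r := by rw [hα]; field_simp
    constructor <;> nlinarith [hs.2]

omit [IsManifold I ∞ N] in
theorem isProperVariation_tentShift (hγ : ContinuousOn γ (Icc a b))
    (hac : Subdivisible (fun c d => ContMDiffOn 𝓘(ℝ, ℝ) I ∞ γ (Icc c d)) a c)
    (hcd : ContMDiffOn 𝓘(ℝ, ℝ) I ∞ γ (Icc c d))
    (hdb : Subdivisible (fun c d => ContMDiffOn 𝓘(ℝ, ℝ) I ∞ γ (Icc c d)) d b) :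
    IsProperVariation I (γ ∘ tentShift c m d) (min (m - c) (d - m)) γ a b := by
  have h1 : 0 < m - c := sub_pos.2 hcm
  have h2 : 0 < d - m := sub_pos.2 hmd
  have hout : ∀ {r s : ℝ}, s ≤ c ∨ d ≤ s → (γ ∘ tentShift c m d) (r, s) = γ s := fun hs => by
    rw [Function.comp_apply, tentShift_of_notMem hcm hmd hs]
  have hsmooth : ∀ {S : Set ℝ} {p q : ℝ}, ContMDiffOn 𝓘(ℝ, ℝ) I ∞ γ (Icc p q) →
      ContMDiffOn 𝓘(ℝ, ℝ × ℝ) I ∞ (fun z : ℝ × ℝ => γ z.2) (S ×ˢ Icc p q) := fun h =>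
    h.comp (contMDiff_iff_contDiff.2 contDiff_snd).contMDiffOn fun z hz => hz.2
  refine isProperVariation_iff.2 ⟨lt_min h1 h2, ?_, ?_, ?_, ?_⟩
  · refine hγ.comp (continuous_tentShift c m d).continuousOn ?_
    rintro ⟨r, s⟩ ⟨hr, hs⟩
    by_cases hs' : s ≤ c ∨ d ≤ s
    · rw [tentShift_of_notMem hcm hmd hs']
      exact hs
    · rw [not_or, not_le, not_le] at hs'
      exact Icc_subset_Icc hac.le hdb.le (tentShift_mem hcm hmd hr ⟨hs'.1.le, hs'.2.le⟩)
  · intro s _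
    simp [tentShift]
  · intro r _
    exact ⟨hout (Or.inl hac.le), hout (Or.inr hdb.le)⟩
  · refine Subdivisible.trans (b := c) (hac.bounded.mono fun p q _ hQ =>
      (hsmooth hQ.1).congr fun z hz => hout (Or.inl (hz.2.2.trans hQ.2.2.le))) ?_
    refine Subdivisible.trans (b := d) ?_ (hdb.bounded.mono fun p q _ hQ =>
      (hsmooth hQ.1).congr fun z hz => hout (Or.inr (hQ.2.1.le.trans hz.2.1)))
    -- The tent has its kinks at c, m and d. On either side of m the shift is polynomial in r and s
    -- jointly, so the composition with γ is smooth on each strip.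
    refine Subdivisible.trans (b := m) (Subdivisible.single hcm ?_) (Subdivisible.single hmd ?_)
    · refine hcd.comp ?_ fun z hz => tentShift_mem hcm hmd hz.1 ⟨hz.2.1, hz.2.2.trans hmd.le⟩
      rw [contMDiffOn_iff_contDiffOn]
      refine ContDiffOn.congr (f := fun z : ℝ × ℝ =>
        (m + z.1 - c) / (m - c) * z.2 + (c - (m + z.1 - c) / (m - c) * c)) ?_
        fun z hz => tentShift_left hcm hmd hz.2
      fun_prop
    · refine hcd.comp ?_ fun z hz => tentShift_mem hcm hmd hz.1 ⟨hcm.le.trans hz.2.1, hz.2.2⟩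
      rw [contMDiffOn_iff_contDiffOn]
      refine ContDiffOn.congr (f := fun z : ℝ × ℝ =>
        (d - m - z.1) / (d - m) * z.2 + (d - (d - m - z.1) / (d - m) * d)) ?_
        fun z hz => tentShift_right hcm hmd hz.2
      fun_prop

/-- The varied curve traverses the same path, so r enters only through the two stretch factors and
the dividing parameter m + r. This makes the energy explicitly differentiable. -/
theorem IsHomogeneousMetric.energy_tentShift (hG : IsHomogeneousMetric I G)
    (hγ : IsPiecewiseSmooth I γ a b)
    (hac : Subdivisible (fun c d => ContMDiffOn 𝓘(ℝ, ℝ) I ∞ γ (Icc c d)) a c)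
    (hcd : ContMDiffOn 𝓘(ℝ, ℝ) I ∞ γ (Icc c d))
    (hdb : Subdivisible (fun c d => ContMDiffOn 𝓘(ℝ, ℝ) I ∞ γ (Icc c d)) d b)
    (hr : r ∈ Ioo (-min (m - c) (d - m)) (min (m - c) (d - m))) :
    energy I G (fun s => (γ ∘ tentShift c m d) (r, s)) a b = 1 / 2 *
      ((∫ s in a..c, G (velocity I γ s) ^ 2) +
        (m + r - c) / (m - c) * (∫ s in c..(m + r), G (velocity I γ s) ^ 2) +
        (d - m - r) / (d - m) * (∫ s in (m + r)..d, G (velocity I γ s) ^ 2) +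
        ∫ s in d..b, G (velocity I γ s) ^ 2) := by
  have h1 : 0 < m - c := sub_pos.2 hcm
  have h2 : 0 < d - m := sub_pos.2 hmd
  have h3 := hr.1
  have h4 := hr.2
  have h5 := min_le_left (m - c) (d - m)
  have h6 := min_le_right (m - c) (d - m)
  set η : ℝ → N := fun s => (γ ∘ tentShift c m d) (r, s) with hη
  have hvar := isProperVariation_tentShift hcm hmd hγ.2.1 hac hcd hdb
  have hηs := (hvar.isPath hγ.1 hr).1
  have hint := hηs.intervalIntegrable (hG.continuous.pow 2)
  have hac' := hac.le
  have hdb' := hdb.le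
  have hsub : ∀ {p q : ℝ}, a ≤ p → p ≤ q → q ≤ b →
      IntervalIntegrable (fun s => G (velocity I η s) ^ 2) volume p q := fun hp hpq hq =>
    hint.mono_set (by
      rw [uIcc_of_le hpq, uIcc_of_le hγ.1.le]
      exact Icc_subset_Icc hp hq)
  have e1 : ∫ s in a..c, G (velocity I η s) ^ 2 = ∫ s in a..c, G (velocity I γ s) ^ 2 :=
    integral_velocity_congr (f := fun v => G v ^ 2) hac' fun s hs => by
      rw [hη]; simp only [Function.comp_apply, tentShift_of_notMem hcm hmd (Or.inl hs.2.le)]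
  have e4 : ∫ s in d..b, G (velocity I η s) ^ 2 = ∫ s in d..b, G (velocity I γ s) ^ 2 :=
    integral_velocity_congr (f := fun v => G v ^ 2) hdb' fun s hs => by
      rw [hη]; simp only [Function.comp_apply, tentShift_of_notMem hcm hmd (Or.inr hs.1.le)]
  have e2 : ∫ s in c..m, G (velocity I η s) ^ 2 =
      (m + r - c) / (m - c) * (∫ s in c..(m + r), G (velocity I γ s) ^ 2) := by
    have k1 : (m + r - c) / (m - c) * c + (c - (m + r - c) / (m - c) * c) = c := by ring
    have k2 : (m + r - c) / (m - c) * m + (c - (m + r - c) / (m - c) * c) = m + r := by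
      field_simp; ring
    have := hG.integral_sq_velocity_affine (α := (m + r - c) / (m - c))
      (β := c - (m + r - c) / (m - c) * c) (div_pos (by linarith) h1) hcm.le hcd k1.ge
      (k2.le.trans (by linarith))
    rw [k1, k2] at this
    rw [← this]
    refine integral_velocity_congr (f := fun v => G v ^ 2) hcm.le fun s hs => ?_
    rw [hη]
    simp only [Function.comp_apply, tentShift_left hcm hmd (Ioo_subset_Icc_self hs)]
  have e3 : ∫ s in m..d, G (velocity I η s) ^ 2 =
      (d - m - r) / (d - m) * (∫ s in (m + r)..d, G (velocity I γ s) ^ 2) := by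
    have k1 : (d - m - r) / (d - m) * d + (d - (d - m - r) / (d - m) * d) = d := by ring
    have k2 : (d - m - r) / (d - m) * m + (d - (d - m - r) / (d - m) * d) = m + r := by
      field_simp; ring
    have := hG.integral_sq_velocity_affine (α := (d - m - r) / (d - m))
      (β := d - (d - m - r) / (d - m) * d) (div_pos (by linarith) h2) hmd.le hcd
      (le_trans (by linarith) k2.ge) k1.le
    rw [k1, k2] at this
    rw [← this]
    refine integral_velocity_congr (f := fun v => G v ^ 2) hmd.le fun s hs => ?_
    rw [hη]
    simp only [Function.comp_apply, tentShift_right hcm hmd (Ioo_subset_Icc_self hs)]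
  rw [energy, ← e1, ← e2, ← e3, ← e4,
    intervalIntegral.integral_add_adjacent_intervals (hsub le_rfl hac' (by linarith))
      (hsub hac' hcm.le (by linarith)),
    intervalIntegral.integral_add_adjacent_intervals (hsub le_rfl (by linarith) (by linarith))
      (hsub (by linarith) hmd.le hdb'),
    intervalIntegral.integral_add_adjacent_intervals (hsub le_rfl (by linarith) (by linarith))
      (hsub (by linarith) hdb' le_rfl)]

end Tent

/-- A geodesic has constant speed on each interval on which it is smooth. -/
theorem IsHomogeneousMetric.exists_speed_eq (hG : IsHomogeneousMetric I G)
    (hγ : IsGeodesic I G γ a b)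
    (hac : Subdivisible (fun c d => ContMDiffOn 𝓘(ℝ, ℝ) I ∞ γ (Icc c d)) a c) (hlt : c < d)
    (hcd : ContMDiffOn 𝓘(ℝ, ℝ) I ∞ γ (Icc c d))
    (hdb : Subdivisible (fun c d => ContMDiffOn 𝓘(ℝ, ℝ) I ∞ γ (Icc c d)) d b) :
    ∃ κ : ℝ, ∀ s ∈ Icc c d, G (velocityWithin I γ (Icc c d) s) = κ := by
  have hcont : ContinuousOn (fun s => G (velocityWithin I γ (Icc c d) s) ^ 2) (Icc c d) :=
    (hG.continuous.pow 2).comp_continuousOn (continuousOn_velocityWithin hlt hcd)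
  -- Extending the squared speed continuously to ℝ makes its primitive A differentiable everywhere,
  -- endpoints included.
  obtain ⟨e, he, hee⟩ : ∃ e : ℝ → ℝ, Continuous e ∧
      ∀ s ∈ Icc c d, e s = G (velocityWithin I γ (Icc c d) s) ^ 2 :=
    ⟨IccExtend hlt.le ((Icc c d).domRestrict fun s => G (velocityWithin I γ (Icc c d) s) ^ 2),
      hcont.domRestrict.Icc_extend', fun s hs => IccExtend_of_mem hlt.le _ hs⟩
  set A : ℝ → ℝ := fun x => ∫ s in c..x, e s with hA
  have hAd : ∀ x, HasDerivAt A (e x) x := fun x =>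
    intervalIntegral.integral_hasDerivAt_right (he.intervalIntegrable _ _)
      he.aestronglyMeasurable.stronglyMeasurableAtFilter he.continuousAt
  have hAe : ∀ p q, c ≤ p → p ≤ q → q ≤ d →
      ∫ s in p..q, G (velocity I γ s) ^ 2 = A q - A p := fun p q hp hpq hq => by
    rw [hA, intervalIntegral.integral_interval_sub_left (he.intervalIntegrable _ _)
      (he.intervalIntegrable _ _), intervalIntegral.integral_of_le hpq,
      intervalIntegral.integral_of_le hpq, integral_Ioc_eq_integral_Ioo,
      integral_Ioc_eq_integral_Ioo]
    refine setIntegral_congr_fun measurableSet_Ioo fun s hs => ?_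
    have hs' : s ∈ Ioo c d := ⟨hp.trans_lt hs.1, hs.2.trans_le hq⟩
    simp only [hee s (Ioo_subset_Icc_self hs'), velocityWithin_Icc hs']
  have hA0 : A c = 0 := by simp [hA]
  -- At r = 0 the terms containing e(m) cancel. Criticality says A(m)/(m - c) = (A(d) - A(m))/(d -
  -- m), equality of the mean squared speeds on the two sides of m, so A is affine on [c, d].
  have hlin : ∀ m ∈ Ioo c d, A m * (d - c) = A d * (m - c) := fun m hm => by
    obtain ⟨hcm, hmd⟩ := hm
    have h1 : 0 < m - c := sub_pos.2 hcm
    have h2 : 0 < d - m := sub_pos.2 hmd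
    have hcrit := hγ.2 _ _ (isProperVariation_tentShift hcm hmd hγ.1.2.1 hac hcd hdb)
    set C₁ := ∫ s in a..c, G (velocity I γ s) ^ 2
    set C₂ := ∫ s in d..b, G (velocity I γ s) ^ 2
    have hE : HasDerivAt (fun r => 1 / 2 * (C₁ + (m + r - c) / (m - c) * A (m + r) +
        (d - m - r) / (d - m) * (A d - A (m + r)) + C₂))
        (1 / 2 * (A m / (m - c) - (A d - A m) / (d - m))) 0 := by
      have d1 : HasDerivAt (fun r => (m + r - c) / (m - c)) (1 / (m - c)) 0 :=
        (((hasDerivAt_id (0 : ℝ)).const_add m).sub_const c).div_const _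
      have d2 : HasDerivAt (fun r => (d - m - r) / (d - m)) (-1 / (d - m)) 0 :=
        ((hasDerivAt_id (0 : ℝ)).const_sub (d - m)).div_const _
      have d3 : HasDerivAt (fun r => A (m + r)) (e m) 0 := by
        have := hAd (m + 0)
        rw [add_zero] at this
        have k := HasDerivAt.comp_const_add (f := A) m 0 (by simpa using this)
        simpa using k
      have := ((((d1.mul d3).const_add C₁).add (d2.mul (d3.const_sub (A d)))).add_const C₂).const_mul
        (1 / 2 : ℝ)
      refine this.congr_deriv ?_
      simp only [add_zero, sub_zero]
      field_simp
      ring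
    have hE' := hE.congr_of_eventuallyEq (f₁ := fun r => energy I G
      (fun s => (γ ∘ tentShift c m d) (r, s)) a b) <| by
      have h0 : Ioo (-min (m - c) (d - m)) (min (m - c) (d - m)) ∈ 𝓝 (0 : ℝ) :=
        Ioo_mem_nhds (neg_lt_zero.2 (lt_min h1 h2)) (lt_min h1 h2)
      filter_upwards [h0] with r hr
      have h5 := min_le_left (m - c) (d - m)
      have h6 := min_le_right (m - c) (d - m)
      rw [hG.energy_tentShift hcm hmd hγ.1 hac hcd hdb hr,
        hAe c (m + r) le_rfl (by linarith [hr.1]) (by linarith [hr.2]),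
        hAe (m + r) d (by linarith [hr.1]) (by linarith [hr.2]) le_rfl, hA0, sub_zero]
    have := hE'.unique hcrit
    field_simp at this
    linarith
  have hcd0 : 0 < d - c := sub_pos.2 hlt
  have hconst : ∀ m ∈ Ioo c d, e m = A d / (d - c) := fun m hm => by
    have k1 := (hAd m).mul_const (d - c)
    have k2 : HasDerivAt (fun m => A d * (m - c)) (A d * 1) m :=
      ((hasDerivAt_id m).sub_const c).const_mul _
    have := k1.unique (k2.congr_of_eventuallyEq
      (by filter_upwards [Ioo_mem_nhds hm.1 hm.2] with x hx using hlin x hx))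
    field_simp
    linarith
  refine ⟨√(A d / (d - c)), fun s hs => ?_⟩
  have : e s = A d / (d - c) := by
    have hcl : IsClosed {s | e s = A d / (d - c)} := isClosed_eq he continuous_const
    rw [← closure_Ioo hlt.ne] at hs
    exact hcl.closure_subset_iff.2 hconst hs
  rw [← this, hee s hs, Real.sqrt_sq (hG.nonneg _)]

/-- A geodesic lifts to a causal curve whose elapsed time is its length. -/
theorem IsHomogeneousMetric.precedes_of_isGeodesic (hG : IsHomogeneousMetric I G)
    (hγ : IsGeodesic I G γ a b) (t₀ : ℝ) :
    Precedes G (t₀, γ a) (t₀ + length I G γ a b, γ b) := by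
  have key : ∀ b', Subdivisible (fun c d => ContMDiffOn 𝓘(ℝ, ℝ) I ∞ γ (Icc c d) ∧
      Subdivisible (fun c d => ContMDiffOn 𝓘(ℝ, ℝ) I ∞ γ (Icc c d)) a c ∧
      Subdivisible (fun c d => ContMDiffOn 𝓘(ℝ, ℝ) I ∞ γ (Icc c d)) d b) a b' →
      a = b' ∨ (IsPiecewiseSmooth I γ a b' ∧
        Precedes G (t₀, γ a) (t₀ + length I G γ a b', γ b')) := fun b' hb' => by
    induction hb' with
    | refl => exact Or.inl rfl
    | @tail c d _ h ih =>
      obtain ⟨hlt, hcd, hac, hdb⟩ := h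
      have hpw := IsPiecewiseSmooth.of_contMDiffOn hlt hcd
      obtain ⟨κ, hκ⟩ := hG.exists_speed_eq hγ hac hlt hcd hdb
      have hlen : length I G γ c d = κ * (d - c) := by
        rw [length, integral_velocity_eq hlt.le, intervalIntegral.integral_congr (g := fun _ => κ),
          intervalIntegral.integral_const, smul_eq_mul, mul_comm]
        rw [uIcc_of_le hlt.le]
        exact hκ
      have hκ0 : 0 ≤ κ := (hκ c ⟨le_rfl, hlt.le⟩) ▸ hG.nonneg _
      have hstep : ∀ t, Precedes G (t, γ c) (t + length I G γ c d, γ d) := fun t => by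
        -- With speed 0 a causal piece would need positive time, but then γ is constant and the two
        -- events coincide. With speed κ > 0 the time function of slope κ is causal. The speeds of
        -- different pieces need not be compared.
        rcases hκ0.eq_or_lt with rfl | hκ0
        · rw [hlen, zero_mul, add_zero]
          exact Or.inl (by rw [eq_of_velocityWithin_eq_zero hlt hcd
            fun s hs => hG.eq_zero (hκ s hs)])
        · refine Or.inr ⟨fun s => t + κ * (s - c), γ, c, d, hlt, .single hlt
            ⟨by fun_prop, hcd, fun s hs => ?_⟩, by simp, by simp [hlen]⟩
          have hd : HasDerivAt (fun s => t + κ * (s - c)) κ s := by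
            simpa using (((hasDerivAt_id s).sub_const c).const_mul κ).const_add t
          rw [hd.hasDerivWithinAt.derivWithin (uniqueDiffOn_Icc hlt s hs), hκ s hs]
          exact ⟨hκ0, le_rfl⟩
      right
      rcases ih with rfl | ⟨h1, h2⟩
      · exact ⟨hpw, hstep t₀⟩
      · refine ⟨h1.trans hpw, ?_⟩
        rw [← hG.length_add h1 hpw, ← add_assoc]
        exact h2.trans (hstep _)
  exact ((key b hγ.1.subdivisible.bounded).resolve_left hγ.1.1.ne).2

end Geodesics

/-! ### Minimizing curves of unit speed are geodesics -/

/-- Differentiation under the integral sign, dominated by a bound for ∂h/∂r on the compact strip of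
half the width. -/
theorem differentiableAt_integral_of_contDiffOn {h : ℝ × ℝ → ℝ} {c d δ : ℝ} (hδ : 0 < δ)
    (hcd : c < d) (hh : ContDiffOn ℝ 1 h (Ioo (-δ) δ ×ˢ Icc c d)) :
    DifferentiableAt ℝ (fun r => ∫ s in c..d, h (r, s)) 0 := by
  set S := Ioo (-δ) δ ×ˢ Icc c d with hS
  have hSu : UniqueDiffOn ℝ S := isOpen_Ioo.uniqueDiffOn.prod (uniqueDiffOn_Icc hcd)
  have hcont : ContinuousOn (fun z => fderivWithin ℝ h S z (1, 0)) S :=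
    (hh.continuousOn_fderivWithin hSu le_rfl).clm_apply continuousOn_const
  have hslice : ∀ {f : ℝ × ℝ → ℝ} {r : ℝ}, r ∈ Ioo (-δ) δ → ContinuousOn f S →
      ContinuousOn (fun s => f (r, s)) (uIcc c d) := fun hr hf => by
    rw [uIcc_of_le hcd.le]
    exact hf.comp (by fun_prop) fun s hs => ⟨hr, hs⟩
  have hK : IsCompact (Icc (-(δ / 2)) (δ / 2) ×ˢ Icc c d) := isCompact_Icc.prod isCompact_Icc
  obtain ⟨C, hC⟩ := hK.exists_bound_of_continuousOn
    (hcont.mono (prod_mono (fun r hr => ⟨by linarith [hr.1], by linarith [hr.2]⟩) subset_rfl))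
  have hmem : Ioo (-(δ / 2)) (δ / 2) ∈ 𝓝 (0 : ℝ) := Ioo_mem_nhds (by linarith) (by linarith)
  have hsub : ∀ r ∈ Ioo (-(δ / 2)) (δ / 2), r ∈ Ioo (-δ) δ := fun r hr =>
    ⟨by linarith [hr.1], by linarith [hr.2]⟩
  have h0 : (0 : ℝ) ∈ Ioo (-δ) δ := ⟨by linarith, hδ⟩
  have huIoc : ∀ {s : ℝ}, s ∈ uIoc c d → s ∈ Icc c d := fun hs => by
    rw [uIoc_of_le hcd.le] at hs
    exact Ioc_subset_Icc_self hs
  refine (intervalIntegral.hasDerivAt_integral_of_dominated_loc_of_deriv_le (μ := volume)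
    (F := fun r s => h (r, s)) (F' := fun r s => fderivWithin ℝ h S (r, s) (1, 0))
    (bound := fun _ => C) hmem ?_ (hslice h0 hh.continuousOn).intervalIntegrable ?_ ?_ ?_
    ?_).2.differentiableAt
  · filter_upwards [hmem] with r hr
    exact (intervalIntegrable_iff.1
      (hslice (hsub r hr) hh.continuousOn).intervalIntegrable).aestronglyMeasurable
  · exact (intervalIntegrable_iff.1 (hslice h0 hcont).intervalIntegrable).aestronglyMeasurable
  · exact Eventually.of_forall fun s hs r hr => hC (r, s) ⟨Ioo_subset_Icc_self hr, huIoc hs⟩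
  · exact intervalIntegrable_const
  · refine Eventually.of_forall fun s hs r hr => ?_
    have hz : (r, s) ∈ S := ⟨hsub r hr, huIoc hs⟩
    have h1 := ((hh.differentiableOn one_ne_zero) (r, s) hz).hasFDerivWithinAt
    have h2 : HasDerivAt (fun r : ℝ => (r, s)) (1, 0) r :=
      (hasDerivAt_id r).prodMk (hasDerivAt_const r s)
    have hmaps : MapsTo (fun r : ℝ => (r, s)) (Ioo (-δ) δ) S := fun r' hr' => ⟨hr', huIoc hs⟩
    have h3 := h1.comp_hasDerivWithinAt r h2.hasDerivWithinAt hmaps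
    exact h3.hasDerivAt (isOpen_Ioo.mem_nhds (hsub r hr))

section Minimizing

variable {E : Type*} [NormedAddCommGroup E] [NormedSpace ℝ E]
  {H : Type*} [TopologicalSpace H] {I : ModelWithCorners ℝ E H}
  {N : Type*} [TopologicalSpace N] [ChartedSpace H N] [IsManifold I ∞ N]
  {G : TangentBundle I N → ℝ} {γ σ : ℝ → N} {a b c d : ℝ}

/-- `γ` is smooth and has unit speed on `[c, d]`. -/
def IsUnitSpeedPiece (G : TangentBundle I N → ℝ) (γ : ℝ → N) (c d : ℝ) : Prop :=
  ContMDiffOn 𝓘(ℝ, ℝ) I ∞ γ (Icc c d) ∧ ∀ s ∈ Icc c d, G (velocityWithin I γ (Icc c d) s) = 1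

omit [IsManifold I ∞ N] in
-- One-sided velocities do not depend on the subdivision. Unit speed therefore passes to the pieces
-- dictated by a variation.
theorem IsUnitSpeedPiece.of_subdivisible (h : Subdivisible (IsUnitSpeedPiece G γ) a b) (hac : a ≤ c)
    (hcd : c < d) (hdb : d ≤ b) (hγ : ContMDiffOn 𝓘(ℝ, ℝ) I ∞ γ (Icc c d)) :
    IsUnitSpeedPiece G γ c d := by
  refine ⟨hγ, fun s hs => ?_⟩
  have hdiff := (hγ.mdifferentiableOn (by simp)) s hs
  rcases hs.2.eq_or_lt with rfl | hsd
  · obtain ⟨p, q, hpq, -, -, hs'⟩ := h.exists_mem_Ioc ⟨hac.trans_lt hcd, hdb⟩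
    have hs'' := Ioc_subset_Icc_self hs'
    rw [← leftVelocity_eq ⟨hcd, le_rfl⟩ hdiff,
      leftVelocity_eq hs' ((hpq.1.mdifferentiableOn (by simp)) s hs'')]
    exact hpq.2 s hs''
  · obtain ⟨p, q, hpq, -, -, hs'⟩ := h.exists_mem_Ico ⟨hac.trans hs.1, hsd.trans_le hdb⟩
    have hs'' := Ico_subset_Icc_self hs'
    rw [← rightVelocity_eq ⟨hs.1, hsd⟩ hdiff,
      rightVelocity_eq hs' ((hpq.1.mdifferentiableOn (by simp)) s hs'')]
    exact hpq.2 s hs''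

/-- The exponent 1 gives the length and the exponent 2 twice the energy. -/
theorem IsHomogeneousMetric.integral_pow_of_unitSpeed (hG : IsHomogeneousMetric I G) (hab : a < b)
    (h : Subdivisible (IsUnitSpeedPiece G γ) a b) (k : ℕ) :
    ∫ s in a..b, G (velocity I γ s) ^ k = b - a := by
  have hpw := IsPiecewiseSmooth.of_subdivisible hab (h.mono fun _ _ _ h => h.1)
  refine hpw.induction (P := fun c d => ∫ s in c..d, G (velocity I γ s) ^ k = d - c)
    (fun c d hac hcd hdb hγ => ?_) fun c d h₁ h₂ h₃ h₄ => ?_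
  · rw [integral_velocity_eq (f := fun v => G v ^ k) hcd.le,
      intervalIntegral.integral_congr (g := fun _ => (1 : ℝ))]
    · simp
    · rw [uIcc_of_le hcd.le]
      intro s hs
      simp only [(IsUnitSpeedPiece.of_subdivisible h hac hcd hdb hγ).2 s hs, one_pow]
  · rw [← intervalIntegral.integral_add_adjacent_intervals
      (h₁.intervalIntegrable (f := fun v => G v ^ k) (hG.continuous.pow k))
      (h₂.intervalIntegrable (f := fun v => G v ^ k) (hG.continuous.pow k)),
      h₃, h₄]
    ring

omit [IsManifold I ∞ N] in
theorem tangentMapWithin_slice {ψ : ℝ × ℝ → N} {S : Set ℝ} {r s : ℝ} (hr : r ∈ S) (hcd : c < d)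
    (hs : s ∈ Icc c d) (h : MDifferentiableOn 𝓘(ℝ, ℝ × ℝ) I ψ (S ×ˢ Icc c d)) :
    tangentMapWithin 𝓘(ℝ, ℝ × ℝ) I ψ (S ×ˢ Icc c d) ⟨(r, s), ((0, 1) : ℝ × ℝ)⟩ =
      velocityWithin I (fun s => ψ (r, s)) (Icc c d) s := by
  have hd : HasDerivAt (fun s : ℝ => (r, s)) ((0, 1) : ℝ × ℝ) s :=
    (hasDerivAt_const s r).prodMk (hasDerivAt_id s)
  exact (velocityWithin_comp_eq_tangentMapWithin (h (r, s) ⟨hr, hs⟩) hd.hasDerivWithinAt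
    (fun s' hs' => ⟨hr, hs'⟩) (uniqueDiffOn_Icc hcd s hs)).symm

/-- G is assumed smooth only off the zero section. Since the speed is 1 at r = 0, uniform continuity
on a compact strip keeps it positive for small r, and there the integrand is smooth. -/
theorem IsHomogeneousMetric.differentiableAt_integral_strip (hG : IsHomogeneousMetric I G)
    {ψ : ℝ × ℝ → N} {ε : ℝ} (hε : 0 < ε) (hcd : c < d)
    (hψ : ContMDiffOn 𝓘(ℝ, ℝ × ℝ) I ∞ ψ (Ioo (-ε) ε ×ˢ Icc c d))
    (h0 : IsUnitSpeedPiece G (fun s => ψ (0, s)) c d) :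
    DifferentiableAt ℝ (fun r => ∫ s in c..d, G (velocity I (fun s => ψ (r, s)) s) ^ 2) 0 := by
  set S := Ioo (-ε) ε ×ˢ Icc c d with hS
  have hSu : UniqueDiffOn ℝ S := isOpen_Ioo.uniqueDiffOn.prod (uniqueDiffOn_Icc hcd)
  set V : ℝ × ℝ → TangentBundle I N := fun z =>
    tangentMapWithin 𝓘(ℝ, ℝ × ℝ) I ψ S ⟨z, ((0, 1) : ℝ × ℝ)⟩ with hV
  have hVs : ContMDiffOn 𝓘(ℝ, ℝ × ℝ) I.tangent ∞ V S := by
    have h1 := hψ.contMDiffOn_tangentMapWithin (m := ∞) le_rfl hSu.uniqueMDiffOn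
    have h2 : ContMDiff 𝓘(ℝ, ℝ × ℝ) 𝓘(ℝ, ℝ × ℝ).tangent ∞
        fun z : ℝ × ℝ => (⟨z, ((0, 1) : ℝ × ℝ)⟩ : TangentBundle 𝓘(ℝ, ℝ × ℝ) (ℝ × ℝ)) :=
      contMDiff_vectorSpace_iff_contDiff.2 contDiff_const
    exact h1.comp h2.contMDiffOn fun z hz => hz
  have hVv : ∀ r ∈ Ioo (-ε) ε, ∀ s ∈ Icc c d, V (r, s) =
      velocityWithin I (fun s => ψ (r, s)) (Icc c d) s := fun r hr s hs =>
    tangentMapWithin_slice hr hcd hs (hψ.mdifferentiableOn (by simp))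
  have hcont : ContinuousOn (fun z => G (V z)) S := hG.continuous.comp_continuousOn hVs.continuousOn
  have h0ε : (0 : ℝ) ∈ Ioo (-ε) ε := ⟨by linarith, hε⟩
  obtain ⟨δ, hδ, hδε, hpos⟩ : ∃ δ > 0, δ < ε ∧ ∀ r ∈ Ioo (-δ) δ, ∀ s ∈ Icc c d, 0 < G (V (r, s)) := by
    have hK : IsCompact (Icc (-(ε / 2)) (ε / 2) ×ˢ Icc c d) := isCompact_Icc.prod isCompact_Icc
    have huc := hK.uniformContinuousOn_of_continuous
      (hcont.mono (prod_mono (fun r hr => ⟨by linarith [hr.1], by linarith [hr.2]⟩) subset_rfl))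
    obtain ⟨δ, hδ, h⟩ := Metric.uniformContinuousOn_iff.1 huc 1 one_pos
    refine ⟨min δ (ε / 2), lt_min hδ (half_pos hε), (min_le_right _ _).trans_lt (by linarith),
      fun r hr s hs => ?_⟩
    have hr1 := min_le_left δ (ε / 2)
    have hr2 := min_le_right δ (ε / 2)
    have := h (r, s) ⟨⟨by linarith [hr.1], by linarith [hr.2]⟩, hs⟩ (0, s)
      ⟨⟨by linarith, by linarith⟩, hs⟩ (by
        rw [Prod.dist_eq, dist_self, max_eq_left dist_nonneg, Real.dist_eq, sub_zero, abs_lt]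
        exact ⟨by linarith [hr.1], by linarith [hr.2]⟩)
    rw [hVv 0 h0ε s hs, h0.2 s hs, Real.dist_eq, abs_lt] at this
    linarith [this.1]
  have hsub : Ioo (-δ) δ ×ˢ Icc c d ⊆ S :=
    prod_mono (Ioo_subset_Ioo (by linarith) hδε.le) subset_rfl
  have hsm : ContDiffOn ℝ 1 (fun z => G (V z) ^ 2) (Ioo (-δ) δ ×ˢ Icc c d) := by
    have h1 : ContMDiffOn 𝓘(ℝ, ℝ × ℝ) 𝓘(ℝ, ℝ) ∞ (fun z => G (V z)) (Ioo (-δ) δ ×ˢ Icc c d) := by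
      refine hG.smooth.comp (hVs.mono hsub) ?_
      rintro ⟨r, s⟩ ⟨hr, hs⟩ hz
      have h2 := hpos r hr s hs
      have h3 : V (r, s) = ⟨(V (r, s)).1, 0⟩ := by rw [← hz]
      rw [h3, hG.map_zero] at h2
      exact h2.ne rfl
    exact ((contMDiffOn_iff_contDiffOn.1 h1).pow 2).of_le (by norm_cast)
  refine (differentiableAt_integral_of_contDiffOn hδ hcd hsm).congr_of_eventuallyEq ?_
  filter_upwards [Ioo_mem_nhds (neg_lt_zero.2 hε) hε] with r hr
  rw [integral_velocity_eq (f := fun v => G v ^ 2) hcd.le]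
  refine intervalIntegral.integral_congr ?_
  rw [uIcc_of_le hcd.le]
  intro s hs
  simp only [hVv r hr s hs]

theorem IsHomogeneousMetric.differentiableAt_energy (hG : IsHomogeneousMetric I G) (hab : a < b)
    {ψ : ℝ × ℝ → N} {ε : ℝ} (hψ : IsProperVariation I ψ ε γ a b)
    (hstrip : ∀ c d, a ≤ c → c < d → d ≤ b →
      ContMDiffOn 𝓘(ℝ, ℝ × ℝ) I ∞ ψ (Ioo (-ε) ε ×ˢ Icc c d) →
      DifferentiableAt ℝ (fun r => ∫ s in c..d, G (velocity I (fun s => ψ (r, s)) s) ^ 2) 0) :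
    DifferentiableAt ℝ (fun r => energy I G (fun s => ψ (r, s)) a b) 0 := by
  obtain ⟨hε, -, hψ0, -, hsub⟩ := isProperVariation_iff.1 hψ
  have hmem : Ioo (-ε) ε ∈ 𝓝 (0 : ℝ) := Ioo_mem_nhds (neg_lt_zero.2 hε) hε
  have key : ∀ b', Subdivisible (fun c d => a ≤ c ∧ d ≤ b ∧
      ContMDiffOn 𝓘(ℝ, ℝ × ℝ) I ∞ ψ (Ioo (-ε) ε ×ˢ Icc c d)) a b' → a = b' ∨
      ((∀ r ∈ Ioo (-ε) ε, IsPiecewiseSmooth I (fun s => ψ (r, s)) a b') ∧ DifferentiableAt ℝ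
        (fun r => ∫ s in a..b', G (velocity I (fun s => ψ (r, s)) s) ^ 2) 0) := fun b' hb' => by
    induction hb' with
    | refl => exact Or.inl rfl
    | @tail c d _ hQ ih =>
      obtain ⟨hcd, hac, hdb, h2⟩ := hQ
      have h3 := hstrip c d hac hcd hdb h2
      have h4 : ∀ r ∈ Ioo (-ε) ε, IsPiecewiseSmooth I (fun s => ψ (r, s)) c d := fun r hr =>
        .of_contMDiffOn hcd (contMDiffOn_slice hr h2)
      right
      rcases ih with rfl | ⟨h5, h6⟩
      · exact ⟨h4, h3⟩
      · refine ⟨fun r hr => (h5 r hr).trans (h4 r hr), (h6.add h3).congr_of_eventuallyEq ?_⟩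
        filter_upwards [hmem] with r hr
        exact (intervalIntegral.integral_add_adjacent_intervals
          ((h5 r hr).intervalIntegrable (hG.continuous.pow 2))
          ((h4 r hr).intervalIntegrable (hG.continuous.pow 2))).symm
  exact ((key b (hsub.bounded.mono fun c d _ hQ =>
    ⟨hQ.2.1.le, hQ.2.2.le, hQ.1⟩)).resolve_left hab.ne).2.const_mul _

/-- A curve of unit speed which minimizes the length is a geodesic. -/
theorem IsHomogeneousMetric.isGeodesic_of_unitSpeed (hG : IsHomogeneousMetric I G) (hab : a < b)
    (h : Subdivisible (IsUnitSpeedPiece G γ) a b) (hmin : finslerDist I G (γ a) (γ b) = b - a) :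
    IsGeodesic I G γ a b := by
  have hγ := IsPiecewiseSmooth.of_subdivisible hab (h.mono fun _ _ _ h => h.1)
  refine ⟨hγ, fun ψ ε hψ => ?_⟩
  obtain ⟨hε, -, hψ0, -, -⟩ := isProperVariation_iff.1 hψ
  have h0ε : (0 : ℝ) ∈ Ioo (-ε) ε := ⟨by linarith, hε⟩
  have hmem : Ioo (-ε) ε ∈ 𝓝 (0 : ℝ) := Ioo_mem_nhds (neg_lt_zero.2 hε) hε
  have hE := hG.differentiableAt_energy hab hψ fun c d hac hcd hdb hQ => by
    have e : EqOn (fun s => ψ (0, s)) γ (Icc c d) := fun s hs =>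
      hψ0 s ⟨hac.trans hs.1, hs.2.trans hdb⟩
    have h1 := IsUnitSpeedPiece.of_subdivisible h hac hcd hdb
      ((contMDiffOn_slice h0ε hQ).congr fun s hs => (e hs).symm)
    refine hG.differentiableAt_integral_strip hε hcd hQ ⟨contMDiffOn_slice h0ε hQ, fun s hs => ?_⟩
    rw [velocityWithin_congr e hs]
    exact h1.2 s hs
  have hloc : IsLocalMin (fun r => energy I G (fun s => ψ (r, s)) a b) 0 := by
    filter_upwards [hmem] with r hr
    have hpath := hψ.isPath hab hr
    have h1 : energy I G (fun s => ψ (0, s)) a b = 1 / 2 * (b - a) := by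
      rw [energy, integral_velocity_congr (f := fun v => G v ^ 2) hab.le
        (η := γ) fun s hs => hψ0 s (Ioo_subset_Icc_self hs), hG.integral_pow_of_unitSpeed hab h]
    have h2 : b - a ≤ length I G (fun s => ψ (r, s)) a b := by
      rw [← hmin]
      exact hG.finslerDist_le hpath
    have hi := hpath.1.intervalIntegrable hG.continuous
    -- Integrating g² ≥ 2g - 1, with equality at g = 1, replaces the Cauchy–Schwarz inequality:
    -- twice the energy is at least 2·length - (b - a), hence at least b - a.
    have h3 : ∫ s in a..b, (2 * G (velocity I (fun s => ψ (r, s)) s) - 1) ≤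
        ∫ s in a..b, G (velocity I (fun s => ψ (r, s)) s) ^ 2 :=
      intervalIntegral.integral_mono_on hab.le ((hi.const_mul 2).sub intervalIntegrable_const)
        (hpath.1.intervalIntegrable (hG.continuous.pow 2)) fun s _ => by
          nlinarith [sq_nonneg (G (velocity I (fun s => ψ (r, s)) s) - 1)]
    rw [intervalIntegral.integral_sub (hi.const_mul 2) intervalIntegrable_const,
      intervalIntegral.integral_const_mul, intervalIntegral.integral_const, smul_eq_mul, mul_one]
      at h3
    rw [length] at h2
    rw [h1, energy]
    linarith
  exact hE.hasDerivAt.congr_deriv (hloc.hasDerivAt_eq_zero hE.hasDerivAt)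

/-- Here G² is evaluated near zero vectors, where it need not be smooth. In a chart ∂ψ/∂s vanishes
at r = 0, so it is O(|r|). As G is bounded by a multiple of the norm, the integral is O(r²) and thus
differentiable at 0. -/
theorem IsHomogeneousMetric.differentiableAt_integral_strip_of_const [I.Boundaryless]
    (hG : IsHomogeneousMetric I G) {ψ : ℝ × ℝ → N} {x : N} {ε : ℝ} (hε : 0 < ε) (hcd : c < d)
    (hψ : ContMDiffOn 𝓘(ℝ, ℝ × ℝ) I ∞ ψ (Ioo (-ε) ε ×ˢ Icc c d))
    (h0 : ∀ s ∈ Icc c d, ψ (0, s) = x) :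
    DifferentiableAt ℝ (fun r => ∫ s in c..d, G (velocity I (fun s => ψ (r, s)) s) ^ 2) 0 := by
  obtain ⟨C, ρ, hC, hρ, hbound⟩ := hG.exists_chart_bound x
  set φ := extChartAt I x with hφ
  have hf : ContMDiffOn 𝓘(ℝ, E) I ∞ φ.symm φ.target := contMDiffOn_extChartAt_symm x
  have h0ε : (0 : ℝ) ∈ Ioo (-ε) ε := ⟨by linarith, hε⟩
  set U := φ.source ∩ φ ⁻¹' Metric.ball (φ x) ρ with hU
  have hUo : IsOpen U := (continuousOn_extChartAt x).isOpen_inter_preimage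
    (isOpen_extChartAt_source x) Metric.isOpen_ball
  obtain ⟨δ, hδ, hδε, hδU⟩ : ∃ δ > 0, δ < ε ∧ ∀ r ∈ Ioo (-δ) δ, ∀ s ∈ Icc c d, ψ (r, s) ∈ U := by
    -- Compactness of [c, d] keeps all curves with small r inside one chart neighbourhood of x.
    have h1 : ∀ᶠ r in 𝓝 (0 : ℝ), ∀ s ∈ Icc c d,
        ((r, s) ∈ Ioo (-ε) ε ×ˢ Icc c d → ψ (r, s) ∈ U) := by
      refine isCompact_Icc.eventually_forall_of_forall_eventually
        (P := fun r s => (r, s) ∈ Ioo (-ε) ε ×ˢ Icc c d → ψ (r, s) ∈ U) fun s hs => ?_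
      have hxU : ψ (0, s) ∈ U := by
        rw [h0 s hs]
        exact ⟨mem_extChartAt_source x, Metric.mem_ball_self hρ⟩
      exact eventually_nhdsWithin_iff.1
        ((hψ.continuousOn (0, s) ⟨h0ε, hs⟩).preimage_mem_nhdsWithin (hUo.mem_nhds hxU))
    obtain ⟨δ, hδ, h2⟩ := Metric.eventually_nhds_iff_ball.1 h1
    refine ⟨min δ (ε / 2), lt_min hδ (half_pos hε), (min_le_right _ _).trans_lt (by linarith),
      fun r hr s hs => ?_⟩
    have hr1 := min_le_left δ (ε / 2)
    have hr2 := min_le_right δ (ε / 2)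
    refine h2 r ?_ s hs ⟨⟨by linarith [hr.1], by linarith [hr.2]⟩, hs⟩
    rw [Real.ball_eq_Ioo]
    exact ⟨by linarith [hr.1], by linarith [hr.2]⟩
  set S := Ioo (-δ) δ ×ˢ Icc c d with hS
  have hSu : UniqueDiffOn ℝ S := isOpen_Ioo.uniqueDiffOn.prod (uniqueDiffOn_Icc hcd)
  have hψS : ContMDiffOn 𝓘(ℝ, ℝ × ℝ) I ∞ ψ S :=
    hψ.mono (prod_mono (Ioo_subset_Ioo (by linarith) hδε.le) subset_rfl)
  have hUS : MapsTo ψ S U := fun z hz => hδU z.1 hz.1 z.2 hz.2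
  set w : ℝ × ℝ → E := φ ∘ ψ with hw
  have hws : ContDiffOn ℝ ∞ w S := by
    refine contMDiffOn_iff_contDiffOn.1 ((contMDiffOn_extChartAt (I := I) (x := x)).comp hψS ?_)
    intro z hz
    rw [← extChartAt_source I]
    exact (hUS hz).1
  have h0δ : (0 : ℝ) ∈ Ioo (-δ) δ := ⟨by linarith, hδ⟩
  set D : ℝ × ℝ → E := fun z => fderivWithin ℝ w S z (0, 1) with hD
  have hDs : ContDiffOn ℝ 1 D S :=
    (hws.fderivWithin hSu (m := 1) (by norm_cast)).clm_apply contDiffOn_const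
  have hslice : ∀ r ∈ Ioo (-δ) δ, ∀ s ∈ Icc c d,
      HasDerivWithinAt (fun s => w (r, s)) (D (r, s)) (Icc c d) s := fun r hr s hs => by
    have h1 := ((hws.differentiableOn (by simp)) (r, s) ⟨hr, hs⟩).hasFDerivWithinAt
    have h2 : HasDerivAt (fun s : ℝ => (r, s)) (0, 1) s :=
      (hasDerivAt_const s r).prodMk (hasDerivAt_id s)
    have hmaps : MapsTo (fun s : ℝ => (r, s)) (Icc c d) S := fun s' hs' => ⟨hr, hs'⟩
    exact h1.comp_hasDerivWithinAt s h2.hasDerivWithinAt hmaps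
  have hD0 : ∀ s ∈ Icc c d, D (0, s) = 0 := fun s hs => by
    refine (uniqueDiffOn_Icc hcd s hs).eq_deriv _ (hslice 0 h0δ s hs) ?_
    refine (hasDerivWithinAt_const s (Icc c d) (φ x)).congr (fun s' hs' => ?_) ?_
    · simp only [hw, Function.comp_apply, h0 s' hs']
    · simp only [hw, Function.comp_apply, h0 s hs]
  set K := Icc (-(δ / 2)) (δ / 2) ×ˢ Icc c d with hK
  have hKS : K ⊆ S := prod_mono (fun r hr => ⟨by linarith [hr.1], by linarith [hr.2]⟩) subset_rfl
  obtain ⟨C', hC'⟩ := (isCompact_Icc.prod isCompact_Icc : IsCompact K).exists_bound_of_continuousOn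
    ((hDs.continuousOn_fderivWithin hSu le_rfl).mono hKS)
  -- Mean value inequality on the convex compact set K, between (0, s), where D vanishes, and (r,
  -- s).
  have hDbound : ∀ r ∈ Icc (-(δ / 2)) (δ / 2), ∀ s ∈ Icc c d, ‖D (r, s)‖ ≤ C' * |r| :=
    fun r hr s hs => by
      have := ((convex_Icc _ _).prod (convex_Icc _ _) : Convex ℝ K).norm_image_sub_le_of_norm_hasFDerivWithin_le
        (fun z hz => (((hDs.differentiableOn one_ne_zero) z (hKS hz)).hasFDerivWithinAt).mono hKS)
        hC' (show ((0 : ℝ), s) ∈ K from ⟨⟨by linarith, by linarith⟩, hs⟩)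
        (show (r, s) ∈ K from ⟨hr, hs⟩)
      rw [hD0 s hs, sub_zero] at this
      refine this.trans_eq ?_
      simp [Prod.norm_def]
  have hmem : Ioo (-(δ / 2)) (δ / 2) ∈ 𝓝 (0 : ℝ) := Ioo_mem_nhds (by linarith) (by linarith)
  have hGb : ∀ r ∈ Ioo (-(δ / 2)) (δ / 2), ∀ s ∈ Icc c d,
      G (velocityWithin I (fun s => ψ (r, s)) (Icc c d) s) ≤ C * (C' * |r|) := fun r hr s hs => by
    have hrδ : r ∈ Ioo (-δ) δ := ⟨by linarith [hr.1], by linarith [hr.2]⟩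
    have e : EqOn (fun s => ψ (r, s)) (φ.symm ∘ fun s => w (r, s)) (Icc c d) := fun s hs =>
      (φ.left_inv (hUS (x := (r, s)) ⟨hrδ, hs⟩).1).symm
    have hmaps : MapsTo (fun s => w (r, s)) (Icc c d) φ.target := fun s hs =>
      (hbound _ (hUS (x := (r, s)) ⟨hrδ, hs⟩).2).1
    rw [velocityWithin_congr e hs, velocityWithin_comp_eq_tangentMapWithin
      ((hf.mdifferentiableOn (by simp)) _ (hmaps hs)) (hslice r hrδ s hs) hmaps
      (uniqueDiffOn_Icc hcd s hs)]
    refine ((hbound _ (hUS (x := (r, s)) ⟨hrδ, hs⟩).2).2 _).trans ?_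
    gcongr
    exact hDbound r (Ioo_subset_Icc_self hr) s hs
  have hO : (fun r => ∫ s in c..d, G (velocity I (fun s => ψ (r, s)) s) ^ 2) =O[𝓝 0]
      fun r : ℝ => ‖r - 0‖ ^ 2 := by
    refine Asymptotics.IsBigO.of_bound ((C * C') ^ 2 * |d - c|) ?_
    filter_upwards [hmem] with r hr
    rw [integral_velocity_eq (f := fun v => G v ^ 2) hcd.le]
    refine (intervalIntegral.norm_integral_le_of_norm_le_const (C := (C * C') ^ 2 * r ^ 2)
      fun s hs => ?_).trans_eq ?_
    · rw [uIoc_of_le hcd.le] at hs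
      rw [Real.norm_of_nonneg (sq_nonneg _)]
      refine (pow_le_pow_left₀ (hG.nonneg _) (hGb r hr s (Ioc_subset_Icc_self hs)) 2).trans_eq ?_
      rw [← sq_abs r]
      ring
    · rw [sub_zero, norm_pow, norm_norm, Real.norm_eq_abs, sq_abs]
      ring
  exact (hO.hasFDerivAt one_lt_two).differentiableAt

theorem IsHomogeneousMetric.isGeodesic_const [I.Boundaryless] (hG : IsHomogeneousMetric I G)
    (hab : a < b) (x : N) : IsGeodesic I G (fun _ => x) a b := by
  refine ⟨(isPath_const (x := x) hab).1, fun ψ ε hψ => ?_⟩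
  obtain ⟨hε, -, hψ0, -, -⟩ := isProperVariation_iff.1 hψ
  have hE := hG.differentiableAt_energy hab hψ fun c d hac hcd hdb hQ =>
    hG.differentiableAt_integral_strip_of_const hε hcd hQ fun s hs =>
      hψ0 s ⟨hac.trans hs.1, hs.2.trans hdb⟩
  have hloc : IsLocalMin (fun r => energy I G (fun s => ψ (r, s)) a b) 0 := by
    refine Eventually.of_forall fun r => ?_
    have h0 : energy I G (fun s => ψ (0, s)) a b = 0 := by
      rw [energy, integral_velocity_congr (f := fun v => G v ^ 2) hab.le
        (η := fun _ => x) fun s hs => hψ0 s (Ioo_subset_Icc_self hs)]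
      simp [velocity_const, hG.map_zero]
    refine h0.trans_le ?_
    exact mul_nonneg (by norm_num)
      (intervalIntegral.integral_nonneg hab.le fun s _ => sq_nonneg _)
  exact hE.hasDerivAt.congr_deriv (hloc.hasDerivAt_eq_zero hE.hasDerivAt)

end Minimizing

/-! ### Reparametrization by time -/

section Inverse

variable {t τ : ℝ → ℝ} {c d : ℝ}

/-- C is the minimum of t' on the compact interval. It yields both strict monotonicity and a
Lipschitz inverse. -/
theorem exists_expansion (hcd : c < d) (ht : ContDiffOn ℝ ∞ t (Icc c d))
    (hpos : ∀ s ∈ Icc c d, 0 < derivWithin t (Icc c d) s) :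
    ∃ C > 0, ∀ x ∈ Icc c d, ∀ y ∈ Icc c d, x ≤ y → C * (y - x) ≤ t y - t x := by
  have hcont : ContinuousOn (derivWithin t (Icc c d)) (Icc c d) :=
    ht.continuousOn_derivWithin (uniqueDiffOn_Icc hcd) (by simp)
  obtain ⟨s₀, hs₀, hmin⟩ := isCompact_Icc.exists_isMinOn (nonempty_Icc.2 hcd.le) hcont
  refine ⟨_, hpos s₀ hs₀, (convex_Icc c d).mul_sub_le_image_sub_of_le_deriv ht.continuousOn
    ((ht.differentiableOn (by simp)).mono interior_subset) fun s hs => ?_⟩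
  rw [interior_Icc] at hs
  rw [← derivWithin_of_mem_nhds (Icc_mem_nhds hs.1 hs.2)]
  exact hmin (Ioo_subset_Icc_self hs)

theorem strictMonoOn_of_derivWithin_pos (hcd : c < d) (ht : ContDiffOn ℝ ∞ t (Icc c d))
    (hpos : ∀ s ∈ Icc c d, 0 < derivWithin t (Icc c d) s) : StrictMonoOn t (Icc c d) := by
  obtain ⟨C, hC, h⟩ := exists_expansion hcd ht hpos
  intro x hx y hy hxy
  have := h x hx y hy hxy.le
  nlinarith

/-- Inverse function theorem up to the endpoints. The inverse is Lipschitz, hence continuous, hence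
differentiable with τ' = 1/(t' ∘ τ). This formula raises the smoothness of τ from Cⁿ to Cⁿ⁺¹. -/
theorem contDiffOn_inverse (hcd : c < d) (ht : ContDiffOn ℝ ∞ t (Icc c d))
    (hpos : ∀ s ∈ Icc c d, 0 < derivWithin t (Icc c d) s)
    (hτ : ∀ s ∈ Icc c d, τ (t s) = s) :
    MapsTo τ (Icc (t c) (t d)) (Icc c d) ∧ ContDiffOn ℝ ∞ τ (Icc (t c) (t d)) ∧
      ∀ u ∈ Icc (t c) (t d), HasDerivWithinAt τ (derivWithin t (Icc c d) (τ u))⁻¹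
        (Icc (t c) (t d)) u := by
  have hmono := strictMonoOn_of_derivWithin_pos hcd ht hpos
  have himg : ∀ u ∈ Icc (t c) (t d), ∃ s ∈ Icc c d, t s = u := fun u hu =>
    intermediate_value_Icc hcd.le ht.continuousOn hu
  have hmaps : MapsTo τ (Icc (t c) (t d)) (Icc c d) := fun u hu => by
    obtain ⟨s, hs, rfl⟩ := himg u hu
    rwa [hτ s hs]
  have hright : ∀ u ∈ Icc (t c) (t d), t (τ u) = u := fun u hu => by
    obtain ⟨s, hs, rfl⟩ := himg u hu
    rw [hτ s hs]
  have hlt : t c < t d := hmono ⟨le_rfl, hcd.le⟩ ⟨hcd.le, le_rfl⟩ hcd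
  have hcont : ContinuousOn τ (Icc (t c) (t d)) := by
    obtain ⟨C, hC, h⟩ := exists_expansion hcd ht hpos
    have hbound : ∀ u ∈ Icc (t c) (t d), ∀ v ∈ Icc (t c) (t d),
        dist (τ u) (τ v) ≤ C⁻¹ * dist u v := fun u hu v hv => by
      rw [inv_mul_eq_div, le_div_iff₀ hC, Real.dist_eq, Real.dist_eq]
      rcases le_total (τ u) (τ v) with huv | huv
      · have := h _ (hmaps hu) _ (hmaps hv) huv
        rw [hright u hu, hright v hv] at this
        rw [abs_of_nonpos (by linarith : τ u - τ v ≤ 0)]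
        linarith [neg_abs_le (u - v)]
      · have := h _ (hmaps hv) _ (hmaps hu) huv
        rw [hright u hu, hright v hv] at this
        rw [abs_of_nonneg (by linarith : 0 ≤ τ u - τ v)]
        linarith [le_abs_self (u - v)]
    exact (LipschitzOnWith.of_dist_le_mul (K := ⟨C⁻¹, (inv_pos.2 hC).le⟩) hbound).continuousOn
  have hderiv : ∀ u ∈ Icc (t c) (t d), HasDerivWithinAt τ (derivWithin t (Icc c d) (τ u))⁻¹
      (Icc (t c) (t d)) u := fun u hu => by
    have h1 := (ht.differentiableOn (by simp) _ (hmaps hu)).hasDerivWithinAt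
    have h2 : HasFDerivWithinAt t ((ContinuousLinearEquiv.unitsEquivAut ℝ
        (Units.mk0 _ (hpos _ (hmaps hu)).ne') : ℝ ≃L[ℝ] ℝ) : ℝ →L[ℝ] ℝ) (Icc c d) (τ u) := by
      have e : ((ContinuousLinearEquiv.unitsEquivAut ℝ
          (Units.mk0 _ (hpos _ (hmaps hu)).ne') : ℝ ≃L[ℝ] ℝ) : ℝ →L[ℝ] ℝ) =
          ContinuousLinearMap.toSpanSingleton ℝ (derivWithin t (Icc c d) (τ u)) := by
        ext
        simp
      rw [e]
      exact h1.hasFDerivWithinAt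
    have h3 := h2.of_local_left_inverse
      (tendsto_nhdsWithin_iff.2 ⟨hcont u hu, eventually_mem_nhdsWithin.mono fun v hv => hmaps hv⟩)
      hu (eventually_mem_nhdsWithin.mono fun v hv => hright v hv)
    exact h3.hasDerivWithinAt.congr_deriv (by simp)
  have hU := uniqueDiffOn_Icc hlt
  refine ⟨hmaps, contDiffOn_infty.2 fun n => ?_, hderiv⟩
  induction n with
  | zero => exact contDiffOn_zero.2 hcont
  | succ n ih =>
    rw [Nat.cast_add, Nat.cast_one, contDiffOn_succ_iff_derivWithin hU]
    refine ⟨fun u hu => (hderiv u hu).differentiableWithinAt, by simp, ?_⟩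
    have h1 : ContDiffOn ℝ n (derivWithin t (Icc c d)) (Icc c d) :=
      (ht.derivWithin (m := ∞) (uniqueDiffOn_Icc hcd) le_rfl).of_le (by norm_cast; exact le_top)
    exact ((h1.comp ih hmaps).inv fun u hu => (hpos _ (hmaps hu)).ne').congr
      fun u hu => (hderiv u hu).derivWithin (hU u hu)

end Inverse

section Reparametrization

variable {E : Type*} [NormedAddCommGroup E] [NormedSpace ℝ E]
  {H : Type*} [TopologicalSpace H] {I : ModelWithCorners ℝ E H}
  {M : Type*} [TopologicalSpace M] [ChartedSpace H M] [IsManifold I ∞ M]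
  {G : TangentBundle I M → ℝ} {t : ℝ → ℝ} {σ : ℝ → M} {a b c d : ℝ}

omit [IsManifold I ∞ M] in
theorem strictMonoOn_of_causal (h : Subdivisible (IsCausalPiece G t σ) a b) :
    StrictMonoOn t (Icc a b) := by
  induction h with
  | refl => simp
  | @tail c d hac hcd ih =>
    have h1 := strictMonoOn_of_derivWithin_pos hcd.1 hcd.2.1 fun s hs => (hcd.2.2.2 s hs).1
    have hac := Subdivisible.le hac
    rw [← Icc_union_Icc_eq_Icc hac hcd.1.le]
    exact ih.union h1 (isGreatest_Icc hac) (isLeast_Icc hcd.1.le)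

/-- If the elapsed time of a causal curve equals the length of its spatial part, then the spatial
part parametrized by time is a curve of unit speed. -/
theorem IsHomogeneousMetric.exists_unitSpeed (hG : IsHomogeneousMetric I G) (hab : a < b)
    (h : Subdivisible (IsCausalPiece G t σ) a b) (hlen : length I G σ a b = t b - t a) :
    ∃ η : ℝ → M, Subdivisible (IsUnitSpeedPiece G η) (t a) (t b) ∧ η (t a) = σ a ∧
      η (t b) = σ b := by
  have hmono := strictMonoOn_of_causal h
  set τ := Function.invFunOn t (Icc a b) with hτ
  have hτt : ∀ s ∈ Icc a b, τ (t s) = s := fun s hs => hmono.injOn.leftInvOn_invFunOn hs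
  refine ⟨σ ∘ τ, ?_, by simp [hτt a ⟨le_rfl, hab.le⟩], by simp [hτt b ⟨hab.le, le_rfl⟩]⟩
  refine h.bounded.map t fun c d hcd hQ => ?_
  obtain ⟨⟨ht, hσ, hle⟩, hac, hdb⟩ := hQ
  have hac' := hac.le
  have hdb' := hdb.le
  have hcd' := Subdivisible.single (Q := IsCausalPiece G t σ) hcd ⟨ht, hσ, hle⟩
  obtain ⟨hpw, htcd, h1⟩ := hG.length_le_of_causal hcd hcd'
  -- Length is at most elapsed time on [a, c], [c, d] and [d, b], and the totals agree, so equality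
  -- holds on each. Degenerate outer intervals are treated apart because they carry no curve.
  have hlen' : length I G σ c d = t d - t c := by
    refine le_antisymm h1 ?_
    obtain ⟨k1, -, k2⟩ := hG.length_le_of_causal (hac'.trans_lt hcd) (hac.trans hcd')
    have k3 : t d - t a ≤ length I G σ a d := by
      rcases hdb'.eq_or_lt with rfl | hlt
      · exact hlen.ge
      · obtain ⟨k4, -, k5⟩ := hG.length_le_of_causal hlt hdb
        rw [← hG.length_add k1 k4] at hlen
        linarith
    rcases hac'.eq_or_lt with rfl | hlt
    · exact k3
    · obtain ⟨k4, -, k5⟩ := hG.length_le_of_causal hlt hac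
      rw [← hG.length_add k4 hpw] at k3
      linarith
  have hti : ContinuousOn (derivWithin t (Icc c d)) (Icc c d) :=
    ht.continuousOn_derivWithin (uniqueDiffOn_Icc hcd) (by simp)
  have hint : ∫ s in c..d, derivWithin t (Icc c d) s = t d - t c :=
    intervalIntegral.integral_eq_sub_of_hasDerivAt_of_le hcd.le ht.continuousOn
      (fun s hs => (ht.differentiableOn (by simp) s
        (Ioo_subset_Icc_self hs)).hasDerivWithinAt.hasDerivAt (Icc_mem_nhds hs.1 hs.2))
      (by rw [← uIcc_of_le hcd.le] at hti ⊢; exact hti.intervalIntegrable)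
  have hσi : ContinuousOn (fun s => G (velocityWithin I σ (Icc c d) s)) (Icc c d) :=
    hG.continuous.comp_continuousOn (continuousOn_velocityWithin hcd hσ)
  -- Two continuous functions, one below the other, with equal integrals coincide.
  have heq : ∀ s ∈ Icc c d, G (velocityWithin I σ (Icc c d) s) = derivWithin t (Icc c d) s := by
    by_contra! hne
    obtain ⟨s, hs, hne⟩ := hne
    have hpos := intervalIntegral.integral_pos hcd (hti.sub hσi)
      (fun s hs => sub_nonneg.2 (hle s (Ioc_subset_Icc_self hs)).2)
      ⟨s, hs, sub_pos.2 ((hle s hs).2.lt_of_ne hne)⟩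
    rw [length, integral_velocity_eq hcd.le] at hlen'
    have i1 : IntervalIntegrable (derivWithin t (Icc c d)) volume c d := by
      rw [← uIcc_of_le hcd.le] at hti ⊢; exact hti.intervalIntegrable
    have i2 : IntervalIntegrable (fun s => G (velocityWithin I σ (Icc c d) s)) volume c d := by
      rw [← uIcc_of_le hcd.le] at hσi ⊢; exact hσi.intervalIntegrable
    have := intervalIntegral.integral_sub i1 i2
    rw [hint, hlen', sub_self] at this
    exact hpos.ne' this
  obtain ⟨hmaps, hτs, hτd⟩ := contDiffOn_inverse hcd ht (fun s hs => (hle s hs).1)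
    fun s hs => hτt s ⟨hac'.trans hs.1, hs.2.trans hdb'⟩
  refine ⟨htcd, hσ.comp (contMDiffOn_iff_contDiffOn.2 hτs) hmaps, fun u hu => ?_⟩
  have hpos := (hle _ (hmaps hu)).1
  rw [velocityWithin_comp ((hσ.mdifferentiableOn (by simp)) _ (hmaps hu)) (hτd u hu) hmaps
    (uniqueDiffOn_Icc htcd u hu)]
  refine (hG.smul (inv_pos.2 hpos).le (σ (τ u)) (velocityWithin I σ (Icc c d) (τ u)).2).trans ?_
  refine (congrArg (fun x : ℝ => (derivWithin t (Icc c d) (τ u))⁻¹ * x) (heq _ (hmaps hu))).trans ?_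
  exact inv_mul_cancel₀ hpos.ne'

end Reparametrization

/-! ### Causal simplicity and minimizing geodesics -/

section Static

variable {E : Type*} [NormedAddCommGroup E] [NormedSpace ℝ E]
  {H : Type*} [TopologicalSpace H] {I : ModelWithCorners ℝ E H} [I.Boundaryless]
  {M : Type*} [TopologicalSpace M] [ChartedSpace H M] [IsManifold I ∞ M] [PreconnectedSpace M]
  {G : TangentBundle I M → ℝ}

namespace IsHomogeneousMetric

theorem precedes_of_finslerDist_lt (hG : IsHomogeneousMetric I G) {p q : ℝ × M}
    (h : p.1 + finslerDist I G p.2 q.2 < q.1) : Precedes G p q := by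
  obtain ⟨σ, a, b, hσ, hlt⟩ := exists_length_lt (hG.exists_isPath p.2 q.2)
    (show finslerDist I G p.2 q.2 < q.1 - p.1 by linarith)
  have := hG.exists_causal_lift hσ.1 _ hlt p.1
  rwa [hσ.2.1, hσ.2.2, add_sub_cancel] at this

omit [I.Boundaryless] [PreconnectedSpace M] in
theorem finslerDist_le_of_precedes (hG : IsHomogeneousMetric I G) {p q : ℝ × M}
    (h : Precedes G p q) : p.1 + finslerDist I G p.2 q.2 ≤ q.1 := by
  rcases h with rfl | ⟨t, σ, a, b, hab, h, rfl, rfl⟩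
  · rw [hG.finslerDist_self, add_zero]
  · obtain ⟨h1, -, h2⟩ := hG.length_le_of_causal hab h
    have := hG.finslerDist_le (x := σ a) (y := σ b) ⟨h1, rfl, rfl⟩
    simp only
    linarith

/-- If the causal future of `(0, x)` is closed, then there is a minimizing geodesic from `x` to every
point. -/
theorem exists_minimizing_geodesic (hG : IsHomogeneousMetric I G) (x y : M)
    (hcl : IsClosed {q | Precedes G (0, x) q}) :
    ∃ (σ : ℝ → M) (a b : ℝ), IsGeodesic I G σ a b ∧ σ a = x ∧ σ b = y ∧
      length I G σ a b = finslerDist I G x y := by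
  have hmem : Precedes G (0, x) (finslerDist I G x y, y) := by
    have htend : Tendsto (fun t : ℝ => (t, y)) (𝓝[>] (finslerDist I G x y))
        (𝓝 (finslerDist I G x y, y)) :=
      (Continuous.tendsto (by fun_prop) _).mono_left nhdsWithin_le_nhds
    -- Every event over y later than d(x, y) lies in the causal future, so closedness includes the
    -- limiting event.
    refine hcl.mem_of_tendsto htend (eventually_mem_nhdsWithin.mono fun t ht => ?_)
    exact hG.precedes_of_finslerDist_lt (by simpa using ht)
  rcases hmem with heq | ⟨t, σ, a, b, hab, h, hp, hq⟩
  · obtain rfl : x = y := congrArg Prod.snd heq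
    exact ⟨fun _ => x, 0, 1, hG.isGeodesic_const one_pos x, rfl, rfl, by
      rw [hG.length_const, hG.finslerDist_self]⟩
  · obtain ⟨hta, rfl⟩ := Prod.ext_iff.1 hp
    obtain ⟨htb, rfl⟩ := Prod.ext_iff.1 hq
    simp only at hta htb
    obtain ⟨h1, h2, h3⟩ := hG.length_le_of_causal hab h
    have h4 := hG.finslerDist_le (x := σ a) (y := σ b) ⟨h1, rfl, rfl⟩
    -- The elapsed time is d(x, y), which is at most the length of σ, which is at most the elapsed
    -- time: all three agree.
    obtain ⟨η, hη, hηa, hηb⟩ := hG.exists_unitSpeed hab h (by linarith)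
    have h5 := hG.integral_pow_of_unitSpeed h2 hη 1
    refine ⟨η, t a, t b, hG.isGeodesic_of_unitSpeed h2 hη ?_, hηa, hηb, ?_⟩
    · rw [hηa, hηb]
      linarith
    · simp only [pow_one] at h5
      rw [length, h5]
      linarith

omit [I.Boundaryless] [PreconnectedSpace M] in
-- The lift of a minimizing geodesic arrives at the earliest possible time p.1 + d. The remaining
-- time is spent waiting.
theorem precedes_iff_of_minimizing_geodesics (hG : IsHomogeneousMetric I G)
    (h : ∀ x y : M, ∃ (σ : ℝ → M) (a b : ℝ), IsGeodesic I G σ a b ∧ σ a = x ∧ σ b = y ∧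
      length I G σ a b = finslerDist I G x y) (p q : ℝ × M) :
    Precedes G p q ↔ p.1 + finslerDist I G p.2 q.2 ≤ q.1 := by
  refine ⟨hG.finslerDist_le_of_precedes, fun hpq => ?_⟩
  obtain ⟨σ, a, b, hσ, ha, hb, hlen⟩ := h p.2 q.2
  have h1 := hG.precedes_of_isGeodesic hσ p.1
  rw [ha, hb, hlen] at h1
  exact h1.trans (hG.precedes_vertical hpq q.2)

end IsHomogeneousMetric

end Static
end FinslerStatic

end

/-! ### The main theorem -/

theorem mainTheorem2 {n : ℕ} (hn : 1 ≤ n) {M : Type*} [TopologicalSpace M]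
    [ChartedSpace (EuclideanSpace ℝ (Fin n)) M] [IsManifold (𝓡 n) ∞ M]
    [T2Space M] [ParacompactSpace M] [ConnectedSpace M]
    (F : TangentBundle (𝓡 n) M → ℝ) (hF : FinslerStatic.IsFinslerMetric (𝓡 n) F)
    (Λ : M → ℝ) (hΛ : ContMDiff (𝓡 n) 𝓘(ℝ, ℝ) ∞ Λ) (hΛ_pos : ∀ x, 0 < Λ x) :
    FinslerStatic.IsCausallySimple (𝓘(ℝ, ℝ).prod (𝓡 n))
        (FinslerStatic.staticL (𝓡 n) Λ F) (FinslerStatic.dt (𝓡 n) M) ↔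
      ∀ x y : M, ∃ (σ : ℝ → M) (a b : ℝ),
        FinslerStatic.IsGeodesic (𝓡 n) (FinslerStatic.opticalMetric (𝓡 n) Λ F) σ a b ∧
        σ a = x ∧ σ b = y ∧
        FinslerStatic.length (𝓡 n) (FinslerStatic.opticalMetric (𝓡 n) Λ F) σ a b =
          FinslerStatic.finslerDist (𝓡 n) (FinslerStatic.opticalMetric (𝓡 n) Λ F) x y := by
  have hG := hF.isHomogeneousMetric_opticalMetric hΛ hΛ_pos
  have hfut : ∀ p, FinslerStatic.causalFuture (𝓘(ℝ, ℝ).prod (𝓡 n))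
      (FinslerStatic.staticL (𝓡 n) Λ F) (FinslerStatic.dt (𝓡 n) M) p =
      {q | FinslerStatic.Precedes (FinslerStatic.opticalMetric (𝓡 n) Λ F) p q} := fun p =>
    Set.ext fun q => hF.causallyRelated_iff hΛ_pos p q
  have hpast : ∀ p, FinslerStatic.causalPast (𝓘(ℝ, ℝ).prod (𝓡 n))
      (FinslerStatic.staticL (𝓡 n) Λ F) (FinslerStatic.dt (𝓡 n) M) p =
      {q | FinslerStatic.Precedes (FinslerStatic.opticalMetric (𝓡 n) Λ F) q p} := fun p =>
    Set.ext fun q => hF.causallyRelated_iff hΛ_pos q p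
  constructor
  · intro h x y
    refine hG.exists_minimizing_geodesic x y ?_
    rw [← hfut]
    exact (h.1 (0, x)).1
  · intro h
    have hiff := hG.precedes_iff_of_minimizing_geodesics h
    refine ⟨fun p => ⟨?_, ?_⟩, ?_⟩
    · simp only [hfut, hiff]
      exact isClosed_le (continuous_const.add
        ((hG.continuous_finslerDist p.2).1.comp continuous_snd)) continuous_fst
    · simp only [hpast, hiff]
      exact isClosed_le (continuous_fst.add
        ((hG.continuous_finslerDist p.2).2.comp continuous_snd)) continuous_const
    -- The time coordinate strictly increases along a causal curve, so its endpoints differ.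
    · rintro ⟨γ, a, b, hγ, hab⟩
      obtain ⟨h1, h2⟩ := (hF.isFutureCausalCurve_iff hΛ_pos γ).1 hγ
      have h3 := (hG.length_le_of_causal h1 h2).2.1
      rw [hab] at h3
      exact lt_irrefl _ h3
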